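/- Let $b>0$, $\sigma>0$, $\alpha,\beta>-1$, $\Lambda=(0,b)$, and put $y=2(x/b)^\sigma-1$. For a weight $\omega>0$ on $\Lambda$ let $(u,v)_\omega=\int_0^b uv\,\omega\,dx$, $\|v\|_\omega=(v,v)_\omega^{1/2}$, and let $L^2_\omega(\Lambda)$ be the space of measurable $v$ with $\|v\|_\omega<\infty$. Let $$w^{(\alpha,\beta,\sigma)}(x)=x^{\sigma(\beta+1)-1}(b^\sigma-x^\sigma)^\alpha,$$ and, for real $\mu,\eta$, $$w_1^\sigma(x)=x^{\sigma-1}x^{\sigma(2(\eta+\mu)-\beta)}(b^\sigma-x^\sigma)^\alpha,\qquad w_2^\sigma(x)=x^{\sigma-1}x^{\sigma(\beta-2\eta)}(b^\sigma-x^\sigma)^{-\alpha}.$$ Let $D_y=\left(\frac{dy}{dx}\right)^{-1}\frac{d}{dx}=\frac{b^\sigma}{2\sigma}x^{1-\sigma}\frac{d}{dx}$ be the (weak) derivative with respect to $y$, and, for an integer $m\ge 0$, let ${\bf B}^m_{\alpha,\beta,\sigma}(\Lambda)$ be the space of measurable $v$ on $\Lambda$ with weak derivatives $D_y^kv\in L^2_{w^{(\alpha+k,\beta+k,\sigma)}}(\Lambda)$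 for $0\le k\le m$. Let $\mathbb P_N$ be the real polynomials of degree at most $N$ and $${}^1\mathcal F_N=\{x^{\sigma(\beta-\eta-\mu)}\psi(x^\sigma):\psi\in\mathbb P_N\},\qquad {}^2\mathcal F_N=\{x^{\sigma\eta}(b^\sigma-x^\sigma)^\alpha\psi(x^\sigma):\psi\in\mathbb P_N\}.$$ For $i=1,2$ the $L^2_{w_i^\sigma}(\Lambda)$-orthogonal projection ${}^i\pi_Nu\in{}^i\mathcal F_N$ of a real function $u$ is defined by $({}^i\pi_Nu-u,v)_{w_i^\sigma}=0$ for all $v\in{}^i\mathcal F_N$. **Theorem.** For every integer $m\ge 0$ there is a constant $c>0$, depending only on $\alpha,\beta,\sigma,b,m$, such that for all real $\mu,\eta$, all integers $N\ge m$ and all $u:\Lambda\to\mathbb R$ the following holds (with $0^{0}=1$ if $N=m=0$). 1. If $x^{-\sigma(\beta-\eta-\mu)}u\in{\bf B}^m_{\alpha,\beta,\sigma}(\Lambda)$, then ${}^1\pi_Nu$ exists and is unique, ${}^1\pi_Nu-u\in L^2_{w_1^\sigma}(\Lambda)$, and $$\|{}^1\pi_Nu-u\|_{w_1^\sigma}\le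 c\,N^{-m}\,\big\|D_y^m\big(x^{-\sigma(\beta-\eta-\mu)}u\big)\big\|_{w^{(\alpha+m,\beta+m,\sigma)}}.$$ 2. If $x^{-\sigma\eta}(b^\sigma-x^\sigma)^{-\alpha}u\in{\bf B}^m_{\alpha,\beta,\sigma}(\Lambda)$, then ${}^2\pi_Nu$ exists and is unique, ${}^2\pi_Nu-u\in L^2_{w_2^\sigma}(\Lambda)$, and $$\|{}^2\pi_Nu-u\|_{w_2^\sigma}\le c\,N^{-m}\,\big\|D_y^m\big(x^{-\sigma\eta}(b^\sigma-x^\sigma)^{-\alpha}u\big)\big\|_{w^{(\alpha+m,\beta+m,\sigma)}}.$$ -/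

import Mathlib

open MeasureTheory Set
open scoped ContDiff

namespace JacobiMuntz

noncomputable section

/-- The weighted inner product `(u, v)_ρ = ∫₀ᵇ u v ρ dx` on `Λ = (0, b)`. -/
def wInner (b : ℝ) (ρ u v : ℝ → ℝ) : ℝ :=
  ∫ x in Ioo 0 b, u x * v x * ρ x

/-- The weighted norm `‖v‖_ρ = (v, v)_ρ^{1/2}`. It is used only for `v ∈ L²_ρ(Λ)`. -/
def wNorm (b : ℝ) (ρ v : ℝ → ℝ) : ℝ :=
  Real.sqrt (wInner b ρ v v)

/-- `v ∈ L²_ρ(Λ)`: `v` is measurable on `Λ = (0, b)` and `∫₀ᵇ v² ρ dx` is finite. -/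
def MemL2 (b : ℝ) (ρ v : ℝ → ℝ) : Prop :=
  AEStronglyMeasurable v (volume.restrict (Ioo 0 b)) ∧
    IntegrableOn (fun x => v x * v x * ρ x) (Ioo 0 b)

/-- The mapped Jacobi weight `w^{(α,β,σ)}(x) = x^{σ(β+1)-1} (b^σ - x^σ)^α`. -/
def w (b α β σ : ℝ) (x : ℝ) : ℝ :=
  x ^ (σ * (β + 1) - 1) * (b ^ σ - x ^ σ) ^ α

/-- `w_1^σ(x) = x^{σ-1} w_1^{(α,β,μ,σ,η)}(x)`, with
`w_1^{(α,β,μ,σ,η)}(x) = x^{σ(2(η+μ)-β)} (b^σ - x^σ)^α`. -/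
def w1 (b α β μ σ η : ℝ) (x : ℝ) : ℝ :=
  x ^ (σ - 1) * (x ^ (σ * (2 * (η + μ) - β)) * (b ^ σ - x ^ σ) ^ α)

/-- `w_2^σ(x) = x^{σ-1} w_2^{(α,β,σ,η)}(x)`, with
`w_2^{(α,β,σ,η)}(x) = x^{σ(β-2η)} (b^σ - x^σ)^{-α}`. -/
def w2 (b α β σ η : ℝ) (x : ℝ) : ℝ :=
  x ^ (σ - 1) * (x ^ (σ * (β - 2 * η)) * (b ^ σ - x ^ σ) ^ (-α))

/-- `a^σ(x) = dy/dx = (2σ/b^σ) x^{σ-1}` for the change of variable `y = 2 (x/b)^σ - 1`. -/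
def aMap (b σ : ℝ) (x : ℝ) : ℝ :=
  2 * σ / b ^ σ * x ^ (σ - 1)

/-- `g` is the weak derivative `D_y v = dv/dy` on `Λ`, where `y = 2 (x/b)^σ - 1`. As a function
of `x` this says that the weak derivative `dv/dx` is `(dy/dx) g`. -/
def IsWeakDy (b σ : ℝ) (v g : ℝ → ℝ) : Prop :=
  LocallyIntegrableOn v (Ioo 0 b) ∧ LocallyIntegrableOn g (Ioo 0 b) ∧
    ∀ φ : ℝ → ℝ, ContDiff ℝ ∞ φ → HasCompactSupport φ → tsupport φ ⊆ Ioo 0 b →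
      ∫ x in Ioo 0 b, v x * deriv φ x = -∫ x in Ioo 0 b, aMap b σ x * g x * φ x

open Classical in
/-- The weak derivative `D_y v` (unique up to null sets of `Λ`; `0` if it does not exist). -/
def Dy (b σ : ℝ) (v : ℝ → ℝ) : ℝ → ℝ :=
  if h : ∃ g, IsWeakDy b σ v g then h.choose else 0

/-- The non-uniformly mapped Jacobi space `B^m_{α,β,σ}(Λ)`: the weak derivatives `D_y^k v`,
`k ≤ m`, exist and `D_y^k v ∈ L²_{w^{(α+k,β+k,σ)}}(Λ)`. -/
def MemB (b α β σ : ℝ) (m : ℕ) (v : ℝ → ℝ) : Prop :=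
  (∀ k < m, ∃ g, IsWeakDy b σ ((Dy b σ)^[k] v) g) ∧
    ∀ k ≤ m, MemL2 b (w b (α + k) (β + k) σ) ((Dy b σ)^[k] v)

/-- The Jacobi–Müntz space `¹F_N` of functions `x^{σ(β-η-μ)} ψ(x^σ)`, `ψ` a polynomial of degree
at most `N`. -/
def F1 (β μ σ η : ℝ) (N : ℕ) : Set (ℝ → ℝ) :=
  {φ | ∃ ψ : Polynomial ℝ, ψ.natDegree ≤ N ∧
    φ = fun x => x ^ (σ * (β - η - μ)) * ψ.eval (x ^ σ)}

/-- The Jacobi–Müntz space `²F_N` of functions `x^{ση} (b^σ - x^σ)^α ψ(x^σ)`, `ψ` a polynomial of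
degree at most `N`. -/
def F2 (b α σ η : ℝ) (N : ℕ) : Set (ℝ → ℝ) :=
  {φ | ∃ ψ : Polynomial ℝ, ψ.natDegree ≤ N ∧
    φ = fun x => x ^ (σ * η) * (b ^ σ - x ^ σ) ^ α * ψ.eval (x ^ σ)}

/-- `p` is the `L²_ρ(Λ)`-orthogonal projection of `u` on the space `F`. -/
def IsOrthProj (b : ℝ) (ρ : ℝ → ℝ) (F : Set (ℝ → ℝ)) (u p : ℝ → ℝ) : Prop :=
  p ∈ F ∧ ∀ v ∈ F, wInner b ρ (p - u) v = 0

end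

end JacobiMuntz

/-! Put A(x) = x^{σ(β-η-μ)} in the first claim and A(x) = x^{ση}(b^σ - x^σ)^α in the second. Since
A² w_i = w, multiplication by A carries the L²_w norm to the L²_{w_i} norm, and it carries
polynomials in t = x^σ to the Müntz space. Both claims thus concern the projection of v = u/A on
polynomials in t with the Jacobi weight w (`orthProj_of_multiplier`).

There one weak derivative is worth one factor 1/n (`IsMuntzProj.sqError_le_deriv`). The Jacobi
operator L in t is symmetric on polynomials, has eigenvalues j(j+α+β+1), and satisfies (v, L s)_w =
(2/b^σ) (D_y v, s') with the weight of parameters α+1, β+1 on the right (`integral_mul_jacobiOp`).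
Let e be the error of the projection of v on degree at most n, and r the projection of e on
polynomials of some large degree. Then r is orthogonal to degree at most n, so r = L s with n² (s,
r) ≤ (r, r) (`exists_preimage_of_orthogonal`). Any χ of degree below n is the derivative of a
polynomial orthogonal to r, hence (r, r) = (v, L s) = (2/b^σ) (D_y v - χ, s'). Cauchy–Schwarz and
(s', s') = (s, L s) = (s, r) give ‖r‖ ≤ 2/(b^σ n) ‖D_y v - χ‖, and density of polynomials passes
from r to e.

Taking for χ the projection of D_y v and repeating m times, with α and β raised by one each time,
gives the rate (`MemB.sqError_le`). Only finite-dimensional spectral theory is used, no infinite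
Jacobi expansion. -/

namespace JacobiMuntz

/-! ### Orthogonality and symmetric operators on polynomials, for an abstract positive definite
form. -/

section PolynomialForms

open Polynomial

variable {Bf : ℝ[X] →ₗ[ℝ] ℝ[X] →ₗ[ℝ] ℝ}

theorem degree_sub_smul_lt {q P : ℝ[X]} {n : ℕ} (hq : q.degree < (n + 1 : ℕ))
    (hP : P.degree < (n + 1 : ℕ)) (hP1 : P.coeff n = 1) :
    (q - q.coeff n • P).degree < (n : ℕ) := by
  rw [degree_lt_iff_coeff_zero] at *
  intro k hk
  rcases hk.eq_or_lt with rfl | hk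
  · simp [hP1]
  · simp [hq k hk, hP k hk]

/-- A positive definite form represents every functional on polynomials of bounded degree. -/
theorem exists_representer (hsymm : ∀ p q, Bf p q = Bf q p) (hpos : ∀ p, p ≠ 0 → 0 < Bf p p)
    (n : ℕ) (l : ℝ[X] →ₗ[ℝ] ℝ) :
    ∃ ψ : ℝ[X], ψ.degree < n ∧ ∀ q : ℝ[X], q.degree < n → Bf ψ q = l q := by
  induction n generalizing l with
  | zero =>
    refine ⟨0, by simp, fun q hq => ?_⟩
    have : q = 0 := by simpa [degree_lt_iff_coeff_zero, Polynomial.ext_iff] using hq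
    simp [this]
  | succ n ih =>
    -- Gram–Schmidt: φ is the projection of `X ^ n` on degree below `n`, so `X ^ n - φ` is a new
    -- orthogonal direction, along which ψ is corrected.
    obtain ⟨φ, hφ, hφ'⟩ := ih (Bf (X ^ n))
    obtain ⟨ψ, hψ, hψ'⟩ := ih l
    set P : ℝ[X] := X ^ n - φ with hPdef
    have hφn : ∀ k, n ≤ k → φ.coeff k = 0 := (degree_lt_iff_coeff_zero _ _).1 hφ
    have hP1 : P.coeff n = 1 := by simp [hPdef, hφn n le_rfl]
    have hPdeg : P.degree < (n + 1 : ℕ) := by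
      rw [degree_lt_iff_coeff_zero]
      intro k hk
      simp [hPdef, hφn k (by omega), coeff_X_pow, show k ≠ n by omega]
    have hPorth : ∀ q : ℝ[X], q.degree < n → Bf P q = 0 := fun q hq => by
      simp [hPdef, hφ' q hq]
    have hPP : 0 < Bf P P := hpos P fun h => by simp [h] at hP1
    refine ⟨ψ + (l P / Bf P P) • P, ?_, fun q hq => ?_⟩
    · have h1 : ψ.degree < (n + 1 : ℕ) := hψ.trans (by exact_mod_cast n.lt_succ_self)
      rw [degree_lt_iff_coeff_zero] at *
      intro k hk
      simp [h1 k hk, hPdeg k hk]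
    · have hq' := degree_sub_smul_lt hq hPdeg hP1
      have e1 : q = q.coeff n • P + (q - q.coeff n • P) := by abel
      set q' := q - q.coeff n • P
      rw [e1]
      have e3 := hPorth ψ hψ
      rw [hsymm] at e3
      simp only [map_add, map_smul, LinearMap.add_apply, LinearMap.smul_apply, smul_eq_mul,
        hψ' _ hq', hPorth _ hq', e3]
      field_simp
      ring

/-- Monic orthogonal polynomials of a positive definite form. -/
theorem exists_orthogonal (hsymm : ∀ p q, Bf p q = Bf q p) (hpos : ∀ p, p ≠ 0 → 0 < Bf p p)
    (n : ℕ) :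
    ∃ P : ℝ[X], P.degree < (n + 1 : ℕ) ∧ P.coeff n = 1 ∧
      ∀ q : ℝ[X], q.degree < n → Bf P q = 0 := by
  obtain ⟨φ, hφ, hφ'⟩ := exists_representer hsymm hpos n (Bf (X ^ n))
  have hφn : ∀ k, n ≤ k → φ.coeff k = 0 := (degree_lt_iff_coeff_zero _ _).1 hφ
  refine ⟨X ^ n - φ, ?_, by simp [hφn n le_rfl], fun q hq => by simp [hφ' q hq]⟩
  rw [degree_lt_iff_coeff_zero]
  intro k hk
  simp [hφn k (by omega), coeff_X_pow, show k ≠ n by omega]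

theorem degree_map_lt {L : ℝ[X] →ₗ[ℝ] ℝ[X]} {lam : ℕ → ℝ}
    (hL : ∀ (p : ℝ[X]) (n : ℕ), p.degree < (n + 1 : ℕ) → (L p).coeff n = lam n * p.coeff n)
    {p : ℝ[X]} {n : ℕ} (hp : p.degree < n) : (L p).degree < n := by
  rw [degree_lt_iff_coeff_zero]
  intro k hk
  rw [hL p k (hp.trans_le (by exact_mod_cast hk.trans k.le_succ)),
    (degree_lt_iff_coeff_zero _ _).1 hp k hk, mul_zero]

/-- Orthogonal polynomials are eigenvectors of a symmetric degree-preserving operator. -/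
theorem orthogonal_eigenvector (hsymm : ∀ p q, Bf p q = Bf q p)
    (hpos : ∀ p, p ≠ 0 → 0 < Bf p p)
    {L : ℝ[X] →ₗ[ℝ] ℝ[X]} {lam : ℕ → ℝ} (hLs : ∀ p q, Bf p (L q) = Bf q (L p))
    (hL : ∀ (p : ℝ[X]) (n : ℕ), p.degree < (n + 1 : ℕ) → (L p).coeff n = lam n * p.coeff n)
    {P : ℝ[X]} {n : ℕ} (hP : P.degree < (n + 1 : ℕ))
    (hPo : ∀ q : ℝ[X], q.degree < n → Bf P q = 0) : L P = lam n • P := by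
  have hD : (L P - lam n • P).degree < n := by
    have h1 := degree_map_lt hL hP
    have h2 := hL P n hP
    rw [degree_lt_iff_coeff_zero] at *
    intro k hk
    rcases hk.eq_or_lt with rfl | hk
    · simp [h2]
    · simp [h1 k hk, hP k hk]
  set D := L P - lam n • P
  by_contra h
  have h3 : D ≠ 0 := fun h0 => h (sub_eq_zero.1 h0)
  have h4 := hpos D h3
  -- The top coefficients cancel in `D`, so both `D` and `L D` have degree below `n` and are
  -- orthogonal to `P`; hence `D` has norm zero.
  have h5 : Bf D D = Bf P (L D) - lam n * Bf P D := by
    rw [show Bf D D = Bf D (L P - lam n • P) from rfl, map_sub, map_smul, hLs D P, hsymm D P,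
      smul_eq_mul]
  rw [h5, hPo _ (degree_map_lt hL hD), hPo _ hD] at h4
  simp at h4

/-- Inversion of a symmetric operator on the complement of polynomials of degree `< N`. -/
theorem exists_preimage_of_orthogonal (hsymm : ∀ p q, Bf p q = Bf q p)
    (hpos : ∀ p, p ≠ 0 → 0 < Bf p p)
    {L : ℝ[X] →ₗ[ℝ] ℝ[X]} {lam : ℕ → ℝ} (hLs : ∀ p q, Bf p (L q) = Bf q (L p))
    (hL : ∀ (p : ℝ[X]) (n : ℕ), p.degree < (n + 1 : ℕ) → (L p).coeff n = lam n * p.coeff n)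
    {κ : ℝ} (hκ : 0 < κ) {N M : ℕ} (hlam : ∀ n, N ≤ n → κ ≤ lam n) (hNM : N ≤ M)
    {r : ℝ[X]} (hr : r.degree < M) (hro : ∀ q : ℝ[X], q.degree < N → Bf r q = 0) :
    ∃ s : ℝ[X], s.degree < M ∧ L s = r ∧ κ * Bf s r ≤ Bf r r := by
  induction M, hNM using Nat.le_induction generalizing r with
  | base =>
    have : r = 0 := by
      by_contra h
      exact (hpos r h).ne' (hro r hr)
    exact ⟨0, by simp, by simp [this], by simp [this]⟩
  | succ M hNM ih =>
    -- Split off the component of `r` along the orthogonal polynomial of degree `M`. There `L` is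
    -- multiplication by `lam M ≥ κ`, and the remainder falls under the induction hypothesis.
    obtain ⟨P, hP, hP1, hPo⟩ := exists_orthogonal hsymm hpos M
    have hr' := degree_sub_smul_lt hr hP hP1
    set c := r.coeff M
    set r' := r - c • P with hr'_def
    have hrr : r = c • P + r' := by rw [hr'_def]; abel
    obtain ⟨s, hs, hLsr, hsκ⟩ := ih hr' fun q hq => by
      rw [hr'_def]
      simp [hro q hq, hPo q (hq.trans_le (by exact_mod_cast hNM))]
    have hl := hlam M hNM
    have hl0 : 0 < lam M := hκ.trans_le hl
    have hPP : 0 ≤ Bf P P := by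
      by_cases h : P = 0
      · simp [h]
      · exact (hpos P h).le
    refine ⟨(c / lam M) • P + s, ?_, ?_, ?_⟩
    · have h1 : s.degree < (M + 1 : ℕ) := hs.trans (by exact_mod_cast M.lt_succ_self)
      rw [degree_lt_iff_coeff_zero] at *
      intro k hk
      simp [h1 k hk, hP k hk]
    · rw [map_add, map_smul, orthogonal_eigenvector hsymm hpos hLs hL hP hPo, hLsr, smul_smul,
        div_mul_cancel₀ _ hl0.ne', ← hrr]
    · rw [hrr]
      have e1 := hPo r' hr'
      have e2 := hPo s hs
      have e3 := hsymm s P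
      have e4 := hsymm r' P
      simp only [map_add, map_smul, LinearMap.add_apply, LinearMap.smul_apply, smul_eq_mul, e1, e2,
        e3, e4]
      have : κ * (c / lam M * (c * Bf P P)) ≤ c * (c * Bf P P) := by
        have h6 : κ / lam M ≤ 1 := (div_le_one hl0).2 hl
        have h7 : 0 ≤ c * (c * Bf P P) := by nlinarith [mul_self_nonneg c]
        calc κ * (c / lam M * (c * Bf P P)) = κ / lam M * (c * (c * Bf P P)) := by ring
          _ ≤ 1 * (c * (c * Bf P P)) := by gcongr
          _ = _ := one_mul _
      linarith

end PolynomialForms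

/-! ### The Jacobi operator in the variable t = x^σ, with B = b^σ. -/

section JacobiOperator

open Polynomial

/-- The Jacobi operator `s ↦ -(t^β (B-t)^α)⁻¹ (t^{β+1} (B-t)^{α+1} s')'` on polynomials. -/
noncomputable def jacobiOp (α β B : ℝ) : ℝ[X] →ₗ[ℝ] ℝ[X] where
  toFun s := -(X * ((C B - X) * derivative (derivative s)) +
    (C (β + 1) * (C B - X) - C (α + 1) * X) * derivative s)
  map_add' p q := by simp only [map_add]; ring
  map_smul' c p := by
    simp only [RingHom.id_apply, smul_eq_C_mul, derivative_C_mul]; ring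

theorem jacobiOp_apply (α β B : ℝ) (s : ℝ[X]) : jacobiOp α β B s =
    -(X * ((C B - X) * derivative (derivative s)) +
    (C (β + 1) * (C B - X) - C (α + 1) * X) * derivative s) := rfl

/-- The operator is triangular in the monomial basis: the terms carrying B lower the degree and the
others keep it. The diagonal entries are therefore the eigenvalues. -/
theorem jacobiOp_coeff (α β B : ℝ) (p : ℝ[X]) (n : ℕ) (hp : p.degree < (n + 1 : ℕ)) :
    (jacobiOp α β B p).coeff n = n * (n + α + β + 1) * p.coeff n := by
  have h := (degree_lt_iff_coeff_zero _ _).1 hp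
  have e : jacobiOp α β B p = X * (X * derivative (derivative p)) -
      C B * (X * derivative (derivative p))
      - C ((β + 1) * B) * derivative p + C (α + β + 2) * (X * derivative p) := by
    rw [jacobiOp_apply]
    simp only [C_add, C_mul, map_ofNat, map_one]
    ring
  rw [e]
  rcases n with _ | _ | n
  · simp [coeff_derivative, h 1 le_rfl]
  · simp only [coeff_add, coeff_sub, coeff_C_mul, coeff_X_mul, coeff_derivative, h 2 le_rfl,
      coeff_X_mul_zero, zero_add]
    push_cast
    ring
  · simp only [coeff_add, coeff_sub, coeff_C_mul, coeff_X_mul, coeff_derivative,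
      h (n + 1 + 1 + 1) le_rfl]
    push_cast
    ring

end JacobiOperator

/-! ### The Jacobi measure, inner products of Müntz polynomials, and their density. -/

section Weight

variable {b α β σ : ℝ}

theorem rpow_lt_of_mem (hσ : 0 < σ) {x : ℝ} (hx : x ∈ Ioo 0 b) : 0 < b ^ σ - x ^ σ :=
  sub_pos.2 (Real.rpow_lt_rpow hx.1.le hx.2 hσ)

theorem w_pos (hσ : 0 < σ) {x : ℝ} (hx : x ∈ Ioo 0 b) : 0 < w b α β σ x :=
  mul_pos (Real.rpow_pos_of_pos hx.1 _) (Real.rpow_pos_of_pos (rpow_lt_of_mem hσ hx) _)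

theorem measurable_w : Measurable (w b α β σ) := by
  unfold w
  fun_prop

theorem integrableOn_rpow_mul_sub_rpow {B : ℝ} (hB : 0 < B) (hα : -1 < α) (hβ : -1 < β) :
    IntegrableOn (fun t : ℝ => t ^ β * (B - t) ^ α) (Ioo 0 B) := by
  -- On each half of the interval only one factor can be singular; this bounds the other one,
  -- whatever the sign of its exponent.
  have key : ∀ {γ : ℝ} {x : ℝ}, B / 2 ≤ x → x ≤ B → x ^ γ ≤ (B / 2) ^ γ + B ^ γ := by
    intro γ x h1 h2
    have hx : 0 < x := by linarith
    have p1 : 0 ≤ (B / 2) ^ γ := by positivity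
    have p2 : 0 ≤ B ^ γ := by positivity
    rcases le_total 0 γ with h | h
    · linarith [Real.rpow_le_rpow hx.le h2 h]
    · linarith [Real.rpow_le_rpow_of_nonpos (by positivity : 0 < B / 2) h1 h]
  have i1 : IntegrableOn (fun t : ℝ => t ^ β) (Ioo 0 B) :=
    ((intervalIntegrable_iff_integrableOn_Ioo_of_le hB.le).1
      (intervalIntegral.intervalIntegrable_rpow' hβ))
  have i2 : IntegrableOn (fun t : ℝ => (B - t) ^ α) (Ioo 0 B) := by
    have h := (intervalIntegral.intervalIntegrable_rpow' (a := 0) (b := B) hα).comp_sub_left B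
    simp only [sub_zero, sub_self] at h
    exact (intervalIntegrable_iff_integrableOn_Ioo_of_le hB.le).1 h.symm
  refine Integrable.mono' ((i1.mul_const ((B / 2) ^ α + B ^ α)).add
    (i2.const_mul ((B / 2) ^ β + B ^ β))) ?_ ?_
  · exact Measurable.aestronglyMeasurable (by fun_prop)
  · filter_upwards [ae_restrict_mem measurableSet_Ioo] with t ht
    have h1 : 0 < t := ht.1
    have h2 : 0 < B - t := sub_pos.2 ht.2
    have p1 : 0 < t ^ β := Real.rpow_pos_of_pos h1 _
    have p2 : 0 < (B - t) ^ α := Real.rpow_pos_of_pos h2 _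
    have q1 : 0 ≤ (B / 2) ^ α + B ^ α := by positivity
    have q2 : 0 ≤ (B / 2) ^ β + B ^ β := by positivity
    rw [Real.norm_of_nonneg (by positivity)]
    simp only [Pi.add_apply]
    rcases le_total t (B / 2) with h | h
    · have := mul_le_mul_of_nonneg_left (key (γ := α) (x := B - t) (by linarith) (by linarith))
        p1.le
      nlinarith [mul_nonneg q2 p2.le]
    · have := mul_le_mul_of_nonneg_right (key (γ := β) (x := t) (by linarith) ht.2.le) p2.le
      nlinarith [mul_nonneg p1.le q1]

theorem integrableOn_w (hb : 0 < b) (hσ : 0 < σ) (hα : -1 < α) (hβ : -1 < β) :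
    IntegrableOn (w b α β σ) (Ioo 0 b) := by
  have hB : 0 < b ^ σ := Real.rpow_pos_of_pos hb _
  have h := integrableOn_rpow_mul_sub_rpow hB hα hβ
  -- Extension by zero, so that the substitution t = x^σ can be made on the whole half-line.
  set f : ℝ → ℝ := (Ioo 0 (b ^ σ)).indicator (fun t : ℝ => t ^ β * (b ^ σ - t) ^ α)
  have h1 : IntegrableOn f (Ioi 0) :=
    ((integrable_indicator_iff measurableSet_Ioo).2 h).integrableOn
  rw [← integrableOn_Ioi_comp_rpow_iff f hσ.ne'] at h1
  have h2 := (h1.mono_set (fun x (hx : x ∈ Ioo 0 b) => hx.1)).const_mul σ⁻¹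
  refine IntegrableOn.congr_fun h2 (fun x hx => ?_) measurableSet_Ioo
  have hx' : x ^ σ ∈ Ioo 0 (b ^ σ) :=
    ⟨Real.rpow_pos_of_pos hx.1 _, Real.rpow_lt_rpow hx.1.le hx.2 hσ⟩
  have e : x ^ (σ * (β + 1) - 1) = x ^ (σ - 1) * (x ^ σ) ^ β := by
    rw [← Real.rpow_mul hx.1.le, ← Real.rpow_add hx.1]
    ring_nf
  simp only [f, indicator_of_mem hx', w, abs_of_pos hσ, smul_eq_mul, e]
  field_simp

/-- The measure `w^{(α,β,σ)} dx` on `(0, b)`. -/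
noncomputable def jacobiMeasure (b α β σ : ℝ) : Measure ℝ :=
  (volume.restrict (Ioo 0 b)).withDensity fun x => ENNReal.ofReal (w b α β σ x)

theorem jacobiMeasure_ac : jacobiMeasure b α β σ ≪ volume.restrict (Ioo 0 b) :=
  withDensity_absolutelyContinuous _ _

theorem ae_jacobiMeasure_mem : ∀ᵐ x ∂jacobiMeasure b α β σ, x ∈ Ioo 0 b :=
  jacobiMeasure_ac.ae_le (ae_restrict_mem measurableSet_Ioo)

theorem integrable_jacobiMeasure_iff (hσ : 0 < σ) {f : ℝ → ℝ} :
    Integrable f (jacobiMeasure b α β σ) ↔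
      IntegrableOn (fun x => f x * w b α β σ x) (Ioo 0 b) := by
  rw [jacobiMeasure, integrable_withDensity_iff measurable_w.ennreal_ofReal (by simp),
    IntegrableOn]
  refine integrable_congr ?_
  filter_upwards [ae_restrict_mem measurableSet_Ioo] with x hx
  rw [ENNReal.toReal_ofReal (w_pos hσ hx).le]

theorem integral_jacobiMeasure (hσ : 0 < σ) (f : ℝ → ℝ) :
    ∫ x, f x ∂jacobiMeasure b α β σ = ∫ x in Ioo 0 b, f x * w b α β σ x := by
  rw [jacobiMeasure, integral_withDensity_eq_integral_toReal_smul measurable_w.ennreal_ofReal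
    (by simp)]
  refine integral_congr_ae ?_
  filter_upwards [ae_restrict_mem measurableSet_Ioo] with x hx
  rw [ENNReal.toReal_ofReal (w_pos hσ hx).le, smul_eq_mul, mul_comm]

theorem wInner_eq (hσ : 0 < σ) (f g : ℝ → ℝ) :
    wInner b (w b α β σ) f g = ∫ x, f x * g x ∂jacobiMeasure b α β σ :=
  (integral_jacobiMeasure hσ _).symm

theorem MemL2.memLp (hσ : 0 < σ) {v : ℝ → ℝ} (h : MemL2 b (w b α β σ) v) :
    MemLp v 2 (jacobiMeasure b α β σ) := by
  rw [memLp_two_iff_integrable_sq (h.1.mono_ac jacobiMeasure_ac),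
    integrable_jacobiMeasure_iff hσ]
  simpa only [sq] using h.2

theorem isFiniteMeasure_jacobiMeasure (hb : 0 < b) (hσ : 0 < σ) (hα : -1 < α) (hβ : -1 < β) :
    IsFiniteMeasure (jacobiMeasure b α β σ) := by
  have h : Integrable (fun _ => (1 : ℝ)) (jacobiMeasure b α β σ) := by
    rw [integrable_jacobiMeasure_iff hσ]
    simpa using integrableOn_w hb hσ hα hβ
  exact (integrable_const_iff.1 h).resolve_left one_ne_zero

/-- The Müntz polynomial `x ↦ p(x^σ)`. -/
noncomputable def muntz (σ : ℝ) (p : Polynomial ℝ) (x : ℝ) : ℝ := p.eval (x ^ σ)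

@[simp] theorem muntz_add (p q : Polynomial ℝ) (x : ℝ) :
    muntz σ (p + q) x = muntz σ p x + muntz σ q x := Polynomial.eval_add

@[simp] theorem muntz_sub (p q : Polynomial ℝ) (x : ℝ) :
    muntz σ (p - q) x = muntz σ p x - muntz σ q x := Polynomial.eval_sub ..

@[simp] theorem muntz_smul (c : ℝ) (p : Polynomial ℝ) (x : ℝ) :
    muntz σ (c • p) x = c * muntz σ p x := by simp [muntz]

theorem continuous_muntz (hσ : 0 < σ) (p : Polynomial ℝ) : Continuous (muntz σ p) :=
  p.continuous.comp (Real.continuous_rpow_const hσ.le)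

theorem exists_muntz_bound (hσ : 0 < σ) (p : Polynomial ℝ) :
    ∃ C, ∀ x ∈ Icc 0 b, |muntz σ p x| ≤ C :=
  isCompact_Icc.exists_bound_of_continuousOn (continuous_muntz hσ p).continuousOn

theorem memLp_muntz (hb : 0 < b) (hσ : 0 < σ) (hα : -1 < α) (hβ : -1 < β) (p : Polynomial ℝ) :
    MemLp (muntz σ p) 2 (jacobiMeasure b α β σ) := by
  have := isFiniteMeasure_jacobiMeasure hb hσ hα hβ
  obtain ⟨C, hC⟩ := exists_muntz_bound (b := b) hσ p
  refine MemLp.of_bound (continuous_muntz hσ p).aestronglyMeasurable C ?_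
  filter_upwards [ae_jacobiMeasure_mem] with x hx
  exact hC x (Ioo_subset_Icc_self hx)

/-- The functional `p ↦ ∫ v(x) p(x^σ) w dx`. -/
noncomputable def muntzFunctional (hb : 0 < b) (hσ : 0 < σ) (hα : -1 < α) (hβ : -1 < β)
    {v : ℝ → ℝ} (hv : MemLp v 2 (jacobiMeasure b α β σ)) : Polynomial ℝ →ₗ[ℝ] ℝ where
  toFun p := ∫ x, v x * muntz σ p x ∂jacobiMeasure b α β σ
  map_add' p q := by
    simp only [muntz_add, mul_add]
    exact integral_add (hv.integrable_mul (memLp_muntz hb hσ hα hβ p))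
      (hv.integrable_mul (memLp_muntz hb hσ hα hβ q))
  map_smul' c p := by
    simp only [muntz_smul, RingHom.id_apply, smul_eq_mul, ← integral_const_mul]
    exact integral_congr_ae (.of_forall fun x => by ring)

/-- The weighted inner product of Müntz polynomials. -/
noncomputable def muntzForm (hb : 0 < b) (hσ : 0 < σ) (hα : -1 < α) (hβ : -1 < β) :
    Polynomial ℝ →ₗ[ℝ] Polynomial ℝ →ₗ[ℝ] ℝ where
  toFun p := muntzFunctional hb hσ hα hβ (memLp_muntz hb hσ hα hβ p)
  map_add' p q := by
    ext1 n
    ext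
    simp only [muntzFunctional, muntz_add, add_mul, LinearMap.comp_apply, LinearMap.coe_mk,
      AddHom.coe_mk, LinearMap.add_apply]
    exact integral_add
      ((memLp_muntz hb hσ hα hβ p).integrable_mul (memLp_muntz hb hσ hα hβ _))
      ((memLp_muntz hb hσ hα hβ q).integrable_mul (memLp_muntz hb hσ hα hβ _))
  map_smul' c p := by
    ext1 n
    ext
    simp only [muntzFunctional, muntz_smul, LinearMap.comp_apply, LinearMap.coe_mk,
      AddHom.coe_mk, LinearMap.smul_apply, RingHom.id_apply, smul_eq_mul, ← integral_const_mul,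
      mul_assoc]

theorem muntzForm_apply (hb : 0 < b) (hσ : 0 < σ) (hα : -1 < α) (hβ : -1 < β)
    (p q : Polynomial ℝ) : muntzForm hb hσ hα hβ p q =
      ∫ x, muntz σ p x * muntz σ q x ∂jacobiMeasure b α β σ := rfl

theorem muntzFunctional_apply (hb : 0 < b) (hσ : 0 < σ) (hα : -1 < α) (hβ : -1 < β)
    {v : ℝ → ℝ} (hv : MemLp v 2 (jacobiMeasure b α β σ)) (p : Polynomial ℝ) :
    muntzFunctional hb hσ hα hβ hv p = ∫ x, v x * muntz σ p x ∂jacobiMeasure b α β σ := rfl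

theorem muntzForm_symm (hb : 0 < b) (hσ : 0 < σ) (hα : -1 < α) (hβ : -1 < β)
    (p q : Polynomial ℝ) : muntzForm hb hσ hα hβ p q = muntzForm hb hσ hα hβ q p := by
  simp only [muntzForm_apply, mul_comm]

theorem eq_zero_of_muntz_eq_zero (hb : 0 < b) (hσ : 0 < σ) {p : Polynomial ℝ}
    (h : ∀ x ∈ Ioo 0 b, muntz σ p x = 0) : p = 0 := by
  refine Polynomial.eq_zero_of_infinite_isRoot p ?_
  refine ((Ioo_infinite hb).image (f := fun x : ℝ => x ^ σ) ?_).mono ?_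
  · intro x hx y hy hxy
    exact (Real.rpow_left_inj hx.1.le hy.1.le hσ.ne').1 hxy
  · rintro _ ⟨x, hx, rfl⟩
    exact h x hx

theorem muntzForm_pos (hb : 0 < b) (hσ : 0 < σ) (hα : -1 < α) (hβ : -1 < β)
    (p : Polynomial ℝ) (hp : p ≠ 0) : 0 < muntzForm hb hσ hα hβ p p := by
  have h0 : 0 ≤ muntzForm hb hσ hα hβ p p := integral_nonneg fun x => mul_self_nonneg _
  refine h0.lt_of_ne fun h => hp ?_
  have hi : IntegrableOn (fun x => muntz σ p x * muntz σ p x * w b α β σ x) (Ioo 0 b) :=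
    (integrable_jacobiMeasure_iff hσ).1 ((memLp_muntz hb hσ hα hβ p).integrable_mul (memLp_muntz hb hσ hα hβ p))
  rw [muntzForm_apply, integral_jacobiMeasure hσ, eq_comm,
    integral_eq_zero_iff_of_nonneg_ae ?_ hi] at h
  · have h2 : muntz σ p =ᵐ[volume.restrict (Ioo 0 b)] 0 := by
      filter_upwards [h, ae_restrict_mem measurableSet_Ioo] with x hx hx'
      have := (w_pos (α := α) (β := β) hσ hx').ne'
      simpa [this] using hx
    exact eq_zero_of_muntz_eq_zero hb hσ (Measure.eqOn_open_of_ae_eq h2 isOpen_Ioo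
      (continuous_muntz hσ p).continuousOn continuousOn_const)
  · filter_upwards [ae_restrict_mem measurableSet_Ioo] with x hx
    exact mul_nonneg (mul_self_nonneg _) (w_pos hσ hx).le

/-- Cauchy–Schwarz for real square-integrable functions. -/
theorem integral_mul_sq_le {X : Type*} [MeasurableSpace X] {μ : Measure X} {f g : X → ℝ}
    (hf : MemLp f 2 μ) (hg : MemLp g 2 μ) :
    (∫ x, f x * g x ∂μ) ^ 2 ≤ (∫ x, f x * f x ∂μ) * ∫ x, g x * g x ∂μ := by
  -- The quadratic t ↦ ‖f + t g‖² is nonnegative, so its discriminant is not positive.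
  have h : ∀ t : ℝ, 0 ≤ (∫ x, g x * g x ∂μ) * (t * t) + (2 * ∫ x, f x * g x ∂μ) * t +
      ∫ x, f x * f x ∂μ := by
    intro t
    have e : (∫ x, g x * g x ∂μ) * (t * t) + (2 * ∫ x, f x * g x ∂μ) * t +
        ∫ x, f x * f x ∂μ = ∫ x, (f x + t * g x) * (f x + t * g x) ∂μ := by
      rw [← integral_mul_const, ← integral_const_mul, ← integral_mul_const, ← integral_add,
        ← integral_add]
      · exact integral_congr_ae (.of_forall fun x => by ring)
      · exact (((hg.integrable_mul hg).mul_const _)).add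
          (((hf.integrable_mul hg).const_mul _).mul_const _)
      · exact hf.integrable_mul hf
      · exact (hg.integrable_mul hg).mul_const _
      · exact ((hf.integrable_mul hg).const_mul _).mul_const _
    rw [e]
    exact integral_nonneg fun x => mul_self_nonneg _
  have := discrim_le_zero h
  rw [discrim] at this
  nlinarith

theorem integral_mul_self_le_of_abs_le {X : Type*} [MeasurableSpace X] {μ : Measure X}
    [IsFiniteMeasure μ] {f : X → ℝ} {C : ℝ} (h : ∀ᵐ x ∂μ, |f x| ≤ C) :
    ∫ x, f x * f x ∂μ ≤ C ^ 2 * μ.real univ := by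
  calc ∫ x, f x * f x ∂μ ≤ ∫ _, C ^ 2 ∂μ := by
        refine integral_mono_of_nonneg (.of_forall fun x => mul_self_nonneg _)
          (integrable_const _) ?_
        filter_upwards [h] with x hx
        calc f x * f x = |f x| ^ 2 := by rw [sq_abs]; ring
          _ ≤ C ^ 2 := by gcongr
    _ = _ := by simp [mul_comm]

/-- Bounded continuous functions are dense in L² of a finite measure, and Weierstrass applied to
g(t^{1/σ}) approximates such a g uniformly by polynomials in x^σ. -/
theorem exists_muntz_approx (hb : 0 < b) (hσ : 0 < σ) (hα : -1 < α) (hβ : -1 < β)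
    {v : ℝ → ℝ} (hv : MemLp v 2 (jacobiMeasure b α β σ)) {ε : ℝ} (hε : 0 < ε) :
    ∃ p : Polynomial ℝ,
      ∫ x, (v x - muntz σ p x) * (v x - muntz σ p x) ∂jacobiMeasure b α β σ ≤ ε := by
  have := isFiniteMeasure_jacobiMeasure hb hσ hα hβ
  set μ := jacobiMeasure b α β σ
  obtain ⟨g, hg, hgm⟩ : ∃ g : BoundedContinuousFunction ℝ ℝ,
      ∫ x, (v x - g x) * (v x - g x) ∂μ ≤ ε / 4 ∧ MemLp g 2 μ := by
    have hv' : MemLp v (ENNReal.ofReal 2) μ := by simpa using hv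
    obtain ⟨g, hg, hgm⟩ := hv'.exists_boundedContinuous_integral_rpow_sub_le (p := 2) (by simp)
      (show 0 < ε / 4 by positivity)
    refine ⟨g, le_trans (le_of_eq ?_) hg, by simpa using hgm⟩
    refine integral_congr_ae (.of_forall fun x => ?_)
    simp [← sq]
  -- Both errors are at most ε/4 because (a + b)² ≤ 2a² + 2b² doubles each; the `+ 1` keeps the
  -- denominator positive.
  set δ : ℝ := Real.sqrt (ε / 4 / (μ.real univ + 1)) with hδ
  have hμ : 0 ≤ μ.real univ := measureReal_nonneg
  have hδ0 : 0 < δ := Real.sqrt_pos.2 (by positivity)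
  have hcont : ContinuousOn (fun t : ℝ => g (t ^ σ⁻¹)) (Icc 0 (b ^ σ)) :=
    (g.continuous.comp (Real.continuous_rpow_const (inv_pos.2 hσ).le)).continuousOn
  obtain ⟨p, hp⟩ := exists_polynomial_near_of_continuousOn _ _ _ hcont δ hδ0
  refine ⟨p, ?_⟩
  have hpg : ∀ᵐ x ∂μ, |g x - muntz σ p x| ≤ δ := by
    filter_upwards [ae_jacobiMeasure_mem] with x hx
    have := hp (x ^ σ) ⟨(Real.rpow_pos_of_pos hx.1 _).le, Real.rpow_le_rpow hx.1.le hx.2.le hσ.le⟩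
    rw [Real.rpow_rpow_inv hx.1.le hσ.ne', abs_sub_comm] at this
    exact this.le
  have h2 := integral_mul_self_le_of_abs_le hpg
  have h3 : δ ^ 2 * μ.real univ ≤ ε / 4 := by
    rw [hδ, Real.sq_sqrt (by positivity), div_mul_eq_mul_div, div_le_iff₀ (by positivity)]
    nlinarith
  have hpm := memLp_muntz hb hσ hα hβ p
  have i1 : Integrable (fun x => (v x - g x) * (v x - g x)) μ := (hv.sub hgm).integrable_mul (hv.sub hgm)
  have i2 : Integrable (fun x => (g x - muntz σ p x) * (g x - muntz σ p x)) μ :=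
    (hgm.sub hpm).integrable_mul (hgm.sub hpm)
  calc ∫ x, (v x - muntz σ p x) * (v x - muntz σ p x) ∂μ
      ≤ ∫ x, (2 * ((v x - g x) * (v x - g x)) +
          2 * ((g x - muntz σ p x) * (g x - muntz σ p x))) ∂μ := by
        refine integral_mono ((hv.sub hpm).integrable_mul (hv.sub hpm))
          ((i1.const_mul 2).add (i2.const_mul 2)) fun x => ?_
        change (v x - muntz σ p x) * (v x - muntz σ p x) ≤ _
        nlinarith [sq_nonneg ((v x - g x) - (g x - muntz σ p x))]
    _ = 2 * (∫ x, (v x - g x) * (v x - g x) ∂μ) +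
          2 * ∫ x, (g x - muntz σ p x) * (g x - muntz σ p x) ∂μ := by
        rw [integral_add (i1.const_mul 2) (i2.const_mul 2)]
        simp only [integral_const_mul]
    _ ≤ ε := by linarith

end Weight

/-! ### Integration by parts against the Jacobi operator, without boundary terms. -/

section IntegrationByParts

open Filter Topology

variable {b α β σ : ℝ}

/-- Smooth cutoffs exhausting `(0, b)`, with slopes controlled by the distance to the boundary. -/
theorem exists_cutoff (b : ℝ) : ∃ (K : ℝ) (χ : ℕ → ℝ → ℝ), (∀ n, ContDiff ℝ ∞ (χ n)) ∧
    (∀ n, tsupport (χ n) ⊆ Icc (1 / (n + 1)) (b - 1 / (n + 1))) ∧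
    (∀ n x, |χ n x| ≤ 1) ∧
    (∀ n, ∀ x ∈ Ioo 0 b, |deriv (χ n) x| * (x * (b - x)) ≤ K) ∧
    ∀ x ∈ Ioo 0 b, ∀ᶠ n in atTop, χ n =ᶠ[𝓝 x] fun _ => 1 := by
  set θ : ℝ → ℝ := fun z => Real.smoothTransition (z - 1) with hθ
  have hθs : ContDiff ℝ ∞ θ := Real.smoothTransition.contDiff.comp (contDiff_id.sub contDiff_const)
  have hθ0 : ∀ z, z ≤ 1 → θ z = 0 := fun z hz =>
    Real.smoothTransition.zero_of_nonpos (by linarith)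
  have hθ1 : ∀ z, 2 ≤ z → θ z = 1 := fun z hz =>
    Real.smoothTransition.one_of_one_le (by linarith)
  have hθa : ∀ z, |θ z| ≤ 1 := fun z => by
    rw [abs_of_nonneg (Real.smoothTransition.nonneg _)]
    exact Real.smoothTransition.le_one _
  have hθd : Differentiable ℝ θ := hθs.differentiable (by simp)
  have hθc : Continuous (deriv θ) := hθs.continuous_deriv (by simp)
  obtain ⟨K, hK⟩ := (isCompact_Icc (a := (0 : ℝ)) (b := 2)).exists_bound_of_continuousOn
    (f := fun z => z * deriv θ z) (continuous_id.mul hθc).continuousOn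
  have hK0 : 0 ≤ K := (norm_nonneg _).trans (hK 0 (by simp))
  -- The product z θ'(z) is invariant under dilation, so the rescaled cutoffs have slopes bounded by
  -- a constant over the distance to the boundary, uniformly in n.
  have hK' : ∀ z, 0 ≤ z → |z * deriv θ z| ≤ K := by
    intro z hz
    rcases le_or_gt z 2 with h | h
    · exact hK z ⟨hz, h⟩
    · have : θ =ᶠ[𝓝 z] fun _ => 1 := by
        filter_upwards [lt_mem_nhds h] with y hy using hθ1 y hy.le
      rw [this.deriv_eq]
      simpa using hK0
  refine ⟨K * b, fun n x => θ ((n + 1) * x) * θ ((n + 1) * (b - x)), fun n => ?_, fun n => ?_,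
    fun n x => ?_, fun n x hx => ?_, fun x hx => ?_⟩
  · exact (hθs.comp (contDiff_const.mul contDiff_id)).mul
      (hθs.comp (contDiff_const.mul (contDiff_const.sub contDiff_id)))
  · refine closure_minimal (fun x hx => ?_) isClosed_Icc
    have hn : (0 : ℝ) < n + 1 := by positivity
    rw [Function.mem_support] at hx
    have h1 := not_le.1 fun h => left_ne_zero_of_mul hx (hθ0 _ h)
    have h2 := not_le.1 fun h => right_ne_zero_of_mul hx (hθ0 _ h)
    constructor
    · rw [div_le_iff₀ hn]
      linarith
    · rw [le_sub_comm, div_le_iff₀ hn]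
      linarith
  · rw [abs_mul]
    exact mul_le_one₀ (hθa _) (abs_nonneg _) (hθa _)
  · have hn : (0 : ℝ) < n + 1 := by positivity
    have hx' : 0 < b - x := sub_pos.2 hx.2
    have d1 : HasDerivAt (fun x => θ ((n + 1) * x)) (deriv θ ((n + 1) * x) * (n + 1)) x :=
      ((hθd _).hasDerivAt).comp x (by simpa using (hasDerivAt_id x).const_mul ((n : ℝ) + 1))
    have d2 : HasDerivAt (fun x => θ ((n + 1) * (b - x)))
        (deriv θ ((n + 1) * (b - x)) * (-(n + 1))) x :=
      ((hθd _).hasDerivAt).comp x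
        (by simpa using ((hasDerivAt_id x).const_sub b).const_mul ((n : ℝ) + 1))
    have hd := (d1.mul d2).deriv
    change deriv (fun x => θ ((n + 1) * x) * θ ((n + 1) * (b - x))) x = _ at hd
    rw [hd]
    set A := deriv θ ((n + 1) * x)
    set D := deriv θ ((n + 1) * (b - x))
    have k1 := hK' ((n + 1) * x) (by have := hx.1; positivity)
    have k2 := hK' ((n + 1) * (b - x)) (by positivity)
    have e : |A * (n + 1) * θ ((n + 1) * (b - x)) + θ ((n + 1) * x) * (D * (-(n + 1)))| *
        (x * (b - x)) = |((n + 1) * x * A) * θ ((n + 1) * (b - x)) * (b - x) -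
          ((n + 1) * (b - x) * D) * θ ((n + 1) * x) * x| := by
      nth_rewrite 1 [← abs_of_pos (mul_pos hx.1 hx')]
      rw [← abs_mul]
      congr 1
      ring
    rw [e]
    calc _ ≤ |((n + 1) * x * A) * θ ((n + 1) * (b - x)) * (b - x)| +
          |((n + 1) * (b - x) * D) * θ ((n + 1) * x) * x| := abs_sub _ _
      _ ≤ K * 1 * (b - x) + K * 1 * x := by
        rw [abs_mul _ (b - x), abs_mul (((n : ℝ) + 1) * x * A),
          abs_mul _ x, abs_mul (((n : ℝ) + 1) * (b - x) * D), abs_of_pos hx', abs_of_pos hx.1]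
        have := hx.1
        gcongr
        · exact hθa _
        · exact hθa _
      _ = K * b := by ring
  · have h1 : ∀ y : ℝ, 0 < y → ∀ᶠ n : ℕ in atTop, 2 < ((n : ℝ) + 1) * y := by
      intro y hy
      obtain ⟨N, hN⟩ := exists_nat_gt (2 / y)
      filter_upwards [eventually_ge_atTop N] with n hn
      rw [div_lt_iff₀ hy] at hN
      have : (N : ℝ) ≤ n := by exact_mod_cast hn
      nlinarith
    filter_upwards [h1 x hx.1, h1 (b - x) (sub_pos.2 hx.2)] with n h2 h3
    have c1 : Continuous fun y : ℝ => ((n : ℝ) + 1) * y := by fun_prop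
    have c2 : Continuous fun y : ℝ => ((n : ℝ) + 1) * (b - y) := by fun_prop
    filter_upwards [c1.continuousAt.eventually (lt_mem_nhds h2),
      c2.continuousAt.eventually (lt_mem_nhds h3)] with y h4 h5
    rw [hθ1 _ h4.le, hθ1 _ h5.le, one_mul]

/-- Powers of x and of b^σ - x^σ may be singular at the endpoints; a cutoff supported inside makes
them legitimate factors of test functions. -/
theorem contDiff_mul_of_tsupport_subset {χ F : ℝ → ℝ} {U : Set ℝ} (hU : IsOpen U)
    (hχ : ContDiff ℝ ∞ χ) (hs : tsupport χ ⊆ U) (hF : ContDiffOn ℝ ∞ F U) :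
    ContDiff ℝ ∞ (fun x => χ x * F x) := by
  rw [contDiff_iff_contDiffAt]
  intro x
  by_cases hx : x ∈ U
  · exact hχ.contDiffAt.mul (hF.contDiffAt (hU.mem_nhds hx))
  · have h0 := notMem_tsupport_iff_eventuallyEq.1 fun h => hx (hs h)
    have : (fun x => χ x * F x) =ᶠ[𝓝 x] fun _ => 0 := by
      filter_upwards [h0] with y hy
      simp [hy]
    exact contDiffAt_const.congr_of_eventuallyEq this

theorem contDiffOn_rpow (b c : ℝ) : ContDiffOn ℝ ∞ (fun x : ℝ => x ^ c) (Ioo 0 b) := fun _ hx =>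
  (Real.contDiffAt_rpow_const_of_ne hx.1.ne').contDiffWithinAt

theorem contDiffOn_muntz (p : Polynomial ℝ) : ContDiffOn ℝ ∞ (muntz σ p) (Ioo 0 b) :=
  (by simpa using p.contDiff_aeval (𝕜 := ℝ) ∞ : ContDiff ℝ ∞ fun t => p.eval t).comp_contDiffOn
    (contDiffOn_rpow b σ)

theorem hasDerivAt_muntz (p : Polynomial ℝ) {x : ℝ} (hx : 0 < x) :
    HasDerivAt (muntz σ p) (σ * x ^ (σ - 1) * muntz σ p.derivative x) x := by
  have h := (p.hasDerivAt (x ^ σ)).comp x (Real.hasDerivAt_rpow_const (p := σ) (Or.inl hx.ne'))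
  rw [mul_comm] at h
  exact h

theorem memL2_muntz (hb : 0 < b) (hσ : 0 < σ) (hα : -1 < α) (hβ : -1 < β) (p : Polynomial ℝ) :
    MemL2 b (w b α β σ) (muntz σ p) :=
  ⟨(continuous_muntz hσ p).aestronglyMeasurable, (integrable_jacobiMeasure_iff hσ).1
    ((memLp_muntz hb hσ hα hβ p).integrable_mul (memLp_muntz hb hσ hα hβ p))⟩

/-- The weak-derivative identity for Müntz polynomials. -/
theorem integral_muntz_mul_deriv (hb : 0 < b) (p : Polynomial ℝ) (φ : ℝ → ℝ)
    (hφ : ContDiff ℝ ∞ φ) (hc : HasCompactSupport φ) (hs : tsupport φ ⊆ Ioo 0 b) :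
    ∫ x in Ioo 0 b, muntz σ p x * deriv φ x =
      -∫ x in Ioo 0 b, aMap b σ x * (b ^ σ / 2 * muntz σ p.derivative x) * φ x := by
  have hB : 0 < b ^ σ := Real.rpow_pos_of_pos hb _
  have hd : ContDiff ℝ ∞ (deriv φ) := (contDiff_infty_iff_deriv.1 hφ).2
  set h : ℝ → ℝ := fun x => φ x * muntz σ p x
  have hh : ContDiff ℝ ∞ h := contDiff_mul_of_tsupport_subset isOpen_Ioo hφ hs (contDiffOn_muntz p)
  have hhc : HasCompactSupport h := hc.mul_right
  have hhi : Integrable (deriv h) :=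
    (hh.continuous_deriv (by simp)).integrable_of_hasCompactSupport hhc.deriv
  have h0 : ∫ x, deriv h x = 0 := integral_eq_zero_of_hasDerivAt_of_integrable
    (fun x => (hh.differentiable (by simp) x).hasDerivAt) hhi
    (hh.continuous.integrable_of_hasCompactSupport hhc)
  have hsub : tsupport h ⊆ Ioo 0 b := (tsupport_mul_subset_left).trans hs
  have h1 : ∫ x in Ioo 0 b, deriv h x = 0 := by
    rw [setIntegral_eq_integral_of_forall_compl_eq_zero, h0]
    intro x hx
    exact image_eq_zero_of_notMem_tsupport fun hx' => hx (hsub (tsupport_deriv_subset hx'))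
  set k : ℝ → ℝ := fun x => deriv φ x * muntz σ p x
  have hk : ContDiff ℝ ∞ k := contDiff_mul_of_tsupport_subset isOpen_Ioo hd
    (tsupport_deriv_subset.trans hs) (contDiffOn_muntz p)
  have hki : Integrable k := hk.continuous.integrable_of_hasCompactSupport hc.deriv.mul_right
  have e : ∀ x ∈ Ioo 0 b,
      aMap b σ x * (b ^ σ / 2 * muntz σ p.derivative x) * φ x = deriv h x - k x := by
    intro x hx
    have hdx := ((hφ.differentiable (by simp) x).hasDerivAt.mul
      (hasDerivAt_muntz (σ := σ) p hx.1)).deriv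
    change deriv h x = _ at hdx
    rw [hdx, aMap]
    simp only [k]
    field_simp
    ring
  rw [setIntegral_congr_fun measurableSet_Ioo e, integral_sub hhi.integrableOn hki.integrableOn,
    h1, zero_sub, neg_neg]
  simp only [k, mul_comm]

/-- With r = x/b, use r ≤ r^σ if σ ≤ 1 and Bernoulli's inequality if σ ≥ 1; the factor 1 + σ covers
both. This lets the flux absorb the cutoff slope at b. -/
theorem rpow_sub_rpow_le (hb : 0 < b) (hσ : 0 < σ) :
    ∃ K, 0 ≤ K ∧ ∀ x ∈ Ioo 0 b, b ^ σ - x ^ σ ≤ K * (b - x) := by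
  have hB : 0 < b ^ σ := Real.rpow_pos_of_pos hb _
  refine ⟨(1 + σ) * (b ^ σ / b), by positivity, fun x hx => ?_⟩
  have hr0 : 0 < x / b := div_pos hx.1 hb
  have hr1 : x / b < 1 := (div_lt_one hb).2 hx.2
  have key : 1 - (x / b) ^ σ ≤ (1 + σ) * (1 - x / b) := by
    rcases le_total σ 1 with h | h
    · have := Real.rpow_le_rpow_of_exponent_ge hr0 hr1.le h
      rw [Real.rpow_one] at this
      nlinarith
    · have := one_add_mul_self_le_rpow_one_add (s := x / b - 1) (by linarith) h
      rw [add_sub_cancel] at this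
      nlinarith
  rw [Real.div_rpow hx.1.le hb.le] at key
  calc b ^ σ - x ^ σ = b ^ σ * (1 - x ^ σ / b ^ σ) := by field_simp
    _ ≤ b ^ σ * ((1 + σ) * (1 - x / b)) := by gcongr
    _ = _ := by field_simp

/-- The flux `x^{σ(β+1)} (b^σ - x^σ)^{α+1} s'(x^σ)`. -/
noncomputable def flux (b α β σ : ℝ) (s : Polynomial ℝ) (x : ℝ) : ℝ :=
  x ^ (σ * (β + 1)) * (b ^ σ - x ^ σ) ^ (α + 1) * muntz σ s.derivative x

theorem contDiffOn_flux (hσ : 0 < σ) (s : Polynomial ℝ) :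
    ContDiffOn ℝ ∞ (flux b α β σ s) (Ioo 0 b) := by
  refine ((contDiffOn_rpow b _).mul ?_).mul (contDiffOn_muntz _)
  exact (contDiffOn_const.sub (contDiffOn_rpow b σ)).rpow_const_of_ne
    fun x hx => (rpow_lt_of_mem hσ hx).ne'

theorem flux_eq (hσ : 0 < σ) (s : Polynomial ℝ) {x : ℝ} (hx : x ∈ Ioo 0 b) :
    flux b α β σ s x =
      w b α β σ x * (x * (b ^ σ - x ^ σ)) * muntz σ s.derivative x := by
  have h1 : x ^ (σ * (β + 1)) = x ^ (σ * (β + 1) - 1) * x := by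
    rw [← Real.rpow_add_one hx.1.ne']; ring_nf
  rw [flux, w, h1, Real.rpow_add_one (rpow_lt_of_mem hσ hx).ne']
  ring

theorem aMap_mul_flux (s : Polynomial ℝ) {x : ℝ} (hx : x ∈ Ioo 0 b) :
    aMap b σ x * flux b α β σ s x =
      2 * σ / b ^ σ * (muntz σ s.derivative x * w b (α + 1) (β + 1) σ x) := by
  have h1 : x ^ (σ * (β + 1 + 1) - 1) = x ^ (σ - 1) * x ^ (σ * (β + 1)) := by
    rw [← Real.rpow_add hx.1]; ring_nf
  rw [flux, w, aMap, h1]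
  ring

/-- The Sturm–Liouville form of the Jacobi operator, pulled back by t = x^σ. -/
theorem hasDerivAt_flux (hσ : 0 < σ) (s : Polynomial ℝ) {x : ℝ} (hx : x ∈ Ioo 0 b) :
    HasDerivAt (flux b α β σ s)
      (-σ * (muntz σ (jacobiOp α β (b ^ σ) s) x * w b α β σ x)) x := by
  have hs := rpow_lt_of_mem hσ hx
  have d1 := Real.hasDerivAt_rpow_const (x := x) (p := σ * (β + 1)) (Or.inl hx.1.ne')
  have d0 := Real.hasDerivAt_rpow_const (x := x) (p := σ) (Or.inl hx.1.ne')
  have d2 := (d0.const_sub (b ^ σ)).rpow_const (p := α + 1) (Or.inl hs.ne')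
  have d3 := hasDerivAt_muntz (σ := σ) s.derivative hx.1
  refine ((d1.mul d2).mul d3).congr_deriv ?_
  have h1 : x ^ (σ * (β + 1)) = x ^ (σ * (β + 1) - 1) * x := by
    rw [← Real.rpow_add_one hx.1.ne']; ring_nf
  have h2 : x ^ (σ - 1) * x = x ^ σ := by
    rw [← Real.rpow_add_one hx.1.ne']; ring_nf
  have h3 : (b ^ σ - x ^ σ) ^ (α + 1) = (b ^ σ - x ^ σ) ^ α * (b ^ σ - x ^ σ) :=
    Real.rpow_add_one hs.ne' _
  have h4 : muntz σ (jacobiOp α β (b ^ σ) s) x =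
      -(x ^ σ * ((b ^ σ - x ^ σ) * muntz σ s.derivative.derivative x) +
        ((β + 1) * (b ^ σ - x ^ σ) - (α + 1) * x ^ σ) * muntz σ s.derivative x) := by
    simp [muntz, jacobiOp_apply]
  simp only [Pi.mul_apply]
  rw [h4, w, add_sub_cancel_right, h1, h3]
  linear_combination (x ^ (σ * (β + 1) - 1) * (b ^ σ - x ^ σ) ^ α * σ *
    ((b ^ σ - x ^ σ) * muntz σ s.derivative.derivative x - (α + 1) * muntz σ s.derivative x)) * h2

/-- Integration by parts against the Jacobi operator. -/
theorem integral_mul_jacobiOp (hb : 0 < b) (hσ : 0 < σ) (hα : -1 < α) (hβ : -1 < β)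
    {v g : ℝ → ℝ} (hv : MemL2 b (w b α β σ) v) (hg : MemL2 b (w b (α + 1) (β + 1) σ) g)
    (hvg : ∀ φ : ℝ → ℝ, ContDiff ℝ ∞ φ → HasCompactSupport φ → tsupport φ ⊆ Ioo 0 b →
      ∫ x in Ioo 0 b, v x * deriv φ x = -∫ x in Ioo 0 b, aMap b σ x * g x * φ x)
    (s : Polynomial ℝ) :
    ∫ x, v x * muntz σ (jacobiOp α β (b ^ σ) s) x ∂jacobiMeasure b α β σ =
      2 / b ^ σ * ∫ x, g x * muntz σ s.derivative x ∂jacobiMeasure b (α + 1) (β + 1) σ := by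
  have hB : 0 < b ^ σ := Real.rpow_pos_of_pos hb _
  obtain ⟨K, χ, hχ, hχs, hχ1, hχd, hχt⟩ := exists_cutoff b
  obtain ⟨K2, hK2, hK2'⟩ := rpow_sub_rpow_le hb hσ
  obtain ⟨C1, hC1⟩ := exists_muntz_bound (b := b) hσ s.derivative
  obtain ⟨C2, hC2⟩ := exists_muntz_bound (b := b) hσ (jacobiOp α β (b ^ σ) s)
  set Ls := jacobiOp α β (b ^ σ) s
  set F := flux b α β σ s with hF
  set φ : ℕ → ℝ → ℝ := fun n x => χ n x * F x with hφ
  have hsub : ∀ n, tsupport (χ n) ⊆ Ioo 0 b := fun n => (hχs n).trans fun x hx => by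
    have : (0 : ℝ) < 1 / (n + 1) := by positivity
    exact ⟨this.trans_le hx.1, by linarith [hx.2]⟩
  have hχc : ∀ n, HasCompactSupport (χ n) := fun n =>
    isCompact_Icc.of_isClosed_subset (isClosed_tsupport _) (hχs n)
  have hφs : ∀ n, ContDiff ℝ ∞ (φ n) := fun n =>
    contDiff_mul_of_tsupport_subset isOpen_Ioo (hχ n) (hsub n) (contDiffOn_flux hσ s)
  have hid : ∀ n, ∫ x in Ioo 0 b, v x * deriv (φ n) x =
      -∫ x in Ioo 0 b, aMap b σ x * g x * φ n x := fun n =>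
    hvg (φ n) (hφs n) (hχc n).mul_right ((tsupport_mul_subset_left).trans (hsub n))
  have hdφ : ∀ n, ∀ x ∈ Ioo 0 b, deriv (φ n) x =
      deriv (χ n) x * F x + χ n x * (-σ * (muntz σ Ls x * w b α β σ x)) := fun n x hx =>
    (((hχ n).differentiable (by simp) x).hasDerivAt.mul (hasDerivAt_flux hσ s hx)).deriv
  have fin0 := isFiniteMeasure_jacobiMeasure (σ := σ) hb hσ hα hβ
  -- The flux is w times x(b^σ - x^σ) times a bounded factor, so χ_n' F is at most a constant times
  -- w. As v is w-integrable, dominated convergence applies, and χ_n' F tends to zero pointwise: no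
  -- boundary term survives.
  have lim1 : Tendsto (fun n => ∫ x in Ioo 0 b, v x * deriv (φ n) x) atTop
      (𝓝 (∫ x in Ioo 0 b, v x * (-σ * (muntz σ Ls x * w b α β σ x)))) := by
    refine tendsto_integral_of_dominated_convergence
      (fun x => (K * K2 * C1 + σ * C2) * (|v x| * w b α β σ x)) (fun n => ?_) ?_ (fun n => ?_) ?_
    · exact hv.1.mul ((hφs n).continuous_deriv (by simp)).aestronglyMeasurable
    · have h1 : Integrable v (jacobiMeasure b α β σ) := (hv.memLp hσ).integrable (by simp)
      exact ((integrable_jacobiMeasure_iff hσ).1 h1.abs).const_mul _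
    · filter_upwards [ae_restrict_mem measurableSet_Ioo] with x hx
      have hw := w_pos (α := α) (β := β) hσ hx
      have hx1 := hx.1
      have hx2 : 0 < b - x := sub_pos.2 hx.2
      have hx' := Ioo_subset_Icc_self hx
      have hrp := rpow_lt_of_mem hσ hx
      have hC10 : 0 ≤ C1 := (abs_nonneg _).trans (hC1 x hx')
      have b1 : |deriv (χ n) x * F x| ≤ K * K2 * C1 * w b α β σ x := by
        rw [hF, flux_eq hσ s hx, abs_mul, abs_mul, abs_of_pos (a := w b α β σ x * _)
          (by positivity)]
        calc |deriv (χ n) x| * (w b α β σ x * (x * (b ^ σ - x ^ σ)) *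
              |muntz σ s.derivative x|)
            ≤ |deriv (χ n) x| * (w b α β σ x * (x * (K2 * (b - x))) * C1) := by
              gcongr
              · exact hK2' x hx
              · exact hC1 x hx'
          _ = |deriv (χ n) x| * (x * (b - x)) * (K2 * C1 * w b α β σ x) := by ring
          _ ≤ K * (K2 * C1 * w b α β σ x) := by
              gcongr
              exact hχd n x hx
          _ = _ := by ring
      have b2 : |χ n x * (-σ * (muntz σ Ls x * w b α β σ x))| ≤ σ * C2 * w b α β σ x := by
        rw [abs_mul, abs_mul, abs_mul, abs_neg, abs_of_pos hσ, abs_of_pos hw]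
        calc |χ n x| * (σ * (|muntz σ Ls x| * w b α β σ x))
            ≤ 1 * (σ * (C2 * w b α β σ x)) := by
              gcongr
              · exact hχ1 n x
              · exact hC2 x hx'
          _ = _ := by ring
      rw [norm_mul, hdφ n x hx, Real.norm_eq_abs, Real.norm_eq_abs]
      calc _ ≤ |v x| * (K * K2 * C1 * w b α β σ x + σ * C2 * w b α β σ x) := by
            gcongr
            exact (abs_add_le _ _).trans (add_le_add b1 b2)
        _ = _ := by ring
    · filter_upwards [ae_restrict_mem measurableSet_Ioo] with x hx
      refine tendsto_const_nhds.congr' ?_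
      filter_upwards [hχt x hx] with n hn
      rw [hdφ n x hx, hn.deriv_eq, hn.eq_of_nhds]
      simp
  have lim2 : Tendsto (fun n => ∫ x in Ioo 0 b, aMap b σ x * g x * φ n x) atTop
      (𝓝 (∫ x in Ioo 0 b,
        2 * σ / b ^ σ * (g x * muntz σ s.derivative x * w b (α + 1) (β + 1) σ x))) := by
    have e : ∀ n, ∀ x ∈ Ioo 0 b, aMap b σ x * g x * φ n x =
        χ n x * (2 * σ / b ^ σ * (g x * muntz σ s.derivative x * w b (α + 1) (β + 1) σ x)) := by
      intro n x hx
      have := aMap_mul_flux (α := α) (β := β) (σ := σ) s hx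
      calc aMap b σ x * g x * φ n x = χ n x * g x * (aMap b σ x * flux b α β σ s x) := by
            simp only [hφ, hF]; ring
        _ = _ := by rw [this]; ring
    have hint : IntegrableOn (fun x =>
        2 * σ / b ^ σ * (g x * muntz σ s.derivative x * w b (α + 1) (β + 1) σ x)) (Ioo 0 b) :=
      ((integrable_jacobiMeasure_iff hσ).1 ((hg.memLp hσ).integrable_mul
        (memLp_muntz hb hσ (by linarith) (by linarith) s.derivative))).const_mul _
    refine Tendsto.congr (fun n => (setIntegral_congr_fun measurableSet_Ioo (e n)).symm) ?_
    refine tendsto_integral_of_dominated_convergence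
      (fun x => ‖2 * σ / b ^ σ * (g x * muntz σ s.derivative x * w b (α + 1) (β + 1) σ x)‖)
      (fun n => ?_) hint.norm (fun n => ?_) ?_
    · exact (hχ n).continuous.aestronglyMeasurable.mul hint.aestronglyMeasurable
    · refine .of_forall fun x => ?_
      rw [norm_mul]
      exact mul_le_of_le_one_left (norm_nonneg _) (hχ1 n x)
    · filter_upwards [ae_restrict_mem measurableSet_Ioo] with x hx
      refine tendsto_const_nhds.congr' ?_
      filter_upwards [hχt x hx] with n hn
      rw [hn.eq_of_nhds, one_mul]
  have h := tendsto_nhds_unique lim1 (by simpa only [hid] using lim2.neg)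
  rw [integral_jacobiMeasure hσ, integral_jacobiMeasure hσ]
  have e1 : ∫ x in Ioo 0 b, v x * (-σ * (muntz σ Ls x * w b α β σ x)) =
      -σ * ∫ x in Ioo 0 b, v x * muntz σ Ls x * w b α β σ x := by
    rw [← integral_const_mul]
    exact integral_congr_ae (.of_forall fun x => by ring)
  rw [e1, integral_const_mul] at h
  have : σ ≠ 0 := hσ.ne'
  field_simp at h ⊢
  linarith

end IntegrationByParts

/-! ### Projection on Müntz polynomials: one-derivative gain, iteration, and transfer by a
multiplier. -/

section Projection

variable {b α β σ : ℝ}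

/-- Integration by parts with v = p(x^σ), whose derivative in y is (b^σ/2) p'(x^σ). The right side
is symmetric in p and s, which makes the operator symmetric. -/
theorem muntzForm_jacobiOp (hb : 0 < b) (hσ : 0 < σ) (hα : -1 < α) (hβ : -1 < β)
    (hα' : -1 < α + 1) (hβ' : -1 < β + 1) (p s : Polynomial ℝ) :
    muntzForm hb hσ hα hβ p (jacobiOp α β (b ^ σ) s) =
      muntzForm hb hσ hα' hβ' p.derivative s.derivative := by
  have hB : 0 < b ^ σ := Real.rpow_pos_of_pos hb _
  have e : muntz σ ((b ^ σ / 2) • p.derivative) =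
      fun x => b ^ σ / 2 * muntz σ p.derivative x := funext fun x => muntz_smul _ _ x
  have h := integral_mul_jacobiOp hb hσ hα hβ (memL2_muntz hb hσ hα hβ p)
    (g := fun x => b ^ σ / 2 * muntz σ p.derivative x)
    (e ▸ memL2_muntz hb hσ hα' hβ' _) (integral_muntz_mul_deriv hb p) s
  rw [muntzForm_apply, muntzForm_apply, h, ← integral_const_mul]
  refine integral_congr_ae (.of_forall fun x => ?_)
  field_simp

theorem exists_derivative_eq (p : Polynomial ℝ) {n : ℕ} (hp : p.degree < n) :
    ∃ q : Polynomial ℝ, q.degree < (n + 1 : ℕ) ∧ q.derivative = p := by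
  refine ⟨∑ k ∈ Finset.range n, Polynomial.monomial (k + 1) (p.coeff k / (k + 1)), ?_, ?_⟩
  · refine (Polynomial.degree_sum_le _ _).trans_lt ?_
    rw [Finset.sup_lt_iff (WithBot.bot_lt_coe _)]
    intro k hk
    refine (Polynomial.degree_monomial_le _ _).trans_lt ?_
    have := Finset.mem_range.1 hk
    exact_mod_cast (by omega : k + 1 < n + 1)
  · rw [Polynomial.derivative_sum]
    ext k
    simp only [Polynomial.derivative_monomial, Polynomial.finsetSum_coeff,
      Polynomial.coeff_monomial, Nat.add_sub_cancel, Finset.sum_ite_eq', Finset.mem_range]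
    split_ifs with hk
    · push_cast
      field_simp
    · exact ((Polynomial.degree_lt_iff_coeff_zero _ _).1 hp k (not_lt.1 hk)).symm

theorem integral_sub_muntz_sq (hb : 0 < b) (hσ : 0 < σ) (hα : -1 < α) (hβ : -1 < β)
    {v : ℝ → ℝ} (hv : MemLp v 2 (jacobiMeasure b α β σ)) (p : Polynomial ℝ) :
    ∫ x, (v x - muntz σ p x) * (v x - muntz σ p x) ∂jacobiMeasure b α β σ =
      (∫ x, v x * v x ∂jacobiMeasure b α β σ) - 2 * muntzFunctional hb hσ hα hβ hv p +
        muntzForm hb hσ hα hβ p p := by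
  have hp := memLp_muntz hb hσ hα hβ p
  have i1 : Integrable (fun x => v x * v x) (jacobiMeasure b α β σ) := hv.integrable_mul hv
  have i2 : Integrable (fun x => v x * muntz σ p x) (jacobiMeasure b α β σ) :=
    hv.integrable_mul hp
  have i3 : Integrable (fun x => muntz σ p x * muntz σ p x) (jacobiMeasure b α β σ) :=
    hp.integrable_mul hp
  have i4 : Integrable (fun x => v x * v x - 2 * (v x * muntz σ p x)) (jacobiMeasure b α β σ) :=
    i1.sub (i2.const_mul 2)
  rw [muntzFunctional_apply, muntzForm_apply, ← integral_const_mul,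
    ← integral_sub i1 (i2.const_mul 2), ← integral_add i4 i3]
  exact integral_congr_ae (.of_forall fun x => by ring)

/-- `ψ` is the weighted orthogonal projection of `v` on Müntz polynomials of degree `< n`. -/
def IsMuntzProj (b α β σ : ℝ) (n : ℕ) (v : ℝ → ℝ) (ψ : Polynomial ℝ) : Prop :=
  ψ.degree < n ∧ ∀ q : Polynomial ℝ, q.degree < n →
    ∫ x, (v x - muntz σ ψ x) * muntz σ q x ∂jacobiMeasure b α β σ = 0

/-- The squared weighted distance from `v` to a Müntz polynomial. -/
noncomputable def sqError (b α β σ : ℝ) (v : ℝ → ℝ) (ψ : Polynomial ℝ) : ℝ :=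
  ∫ x, (v x - muntz σ ψ x) * (v x - muntz σ ψ x) ∂jacobiMeasure b α β σ

theorem integral_sub_mul_muntz (hb : 0 < b) (hσ : 0 < σ) (hα : -1 < α) (hβ : -1 < β)
    {v : ℝ → ℝ} (hv : MemLp v 2 (jacobiMeasure b α β σ)) (ψ q : Polynomial ℝ) :
    ∫ x, (v x - muntz σ ψ x) * muntz σ q x ∂jacobiMeasure b α β σ =
      muntzFunctional hb hσ hα hβ hv q - muntzForm hb hσ hα hβ ψ q := by
  have hq := memLp_muntz hb hσ hα hβ q
  rw [muntzFunctional_apply, muntzForm_apply, ← integral_sub]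
  · exact integral_congr_ae (.of_forall fun x => sub_mul _ _ _)
  · exact hv.integrable_mul hq
  · exact (memLp_muntz hb hσ hα hβ ψ).integrable_mul hq

theorem exists_isMuntzProj (hb : 0 < b) (hσ : 0 < σ) (hα : -1 < α) (hβ : -1 < β)
    {v : ℝ → ℝ} (hv : MemLp v 2 (jacobiMeasure b α β σ)) (n : ℕ) :
    ∃ ψ, IsMuntzProj b α β σ n v ψ := by
  obtain ⟨ψ, h, h'⟩ := exists_representer (muntzForm_symm hb hσ hα hβ)
    (muntzForm_pos hb hσ hα hβ) n (muntzFunctional hb hσ hα hβ hv)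
  exact ⟨ψ, h, fun q hq => by rw [integral_sub_mul_muntz hb hσ hα hβ hv, h' q hq, sub_self]⟩

theorem IsMuntzProj.unique (hb : 0 < b) (hσ : 0 < σ) (hα : -1 < α) (hβ : -1 < β)
    {v : ℝ → ℝ} (hv : MemLp v 2 (jacobiMeasure b α β σ)) {n : ℕ} {ψ χ : Polynomial ℝ}
    (hψ : IsMuntzProj b α β σ n v ψ) (hχ : IsMuntzProj b α β σ n v χ) : ψ = χ := by
  by_contra h
  have hd : (ψ - χ).degree < n :=
    (Polynomial.degree_sub_le _ _).trans_lt (max_lt hψ.1 hχ.1)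
  have h1 := hψ.2 _ hd
  have h2 := hχ.2 _ hd
  rw [integral_sub_mul_muntz hb hσ hα hβ hv] at h1 h2
  have h3 := muntzForm_pos hb hσ hα hβ _ (sub_ne_zero.2 h)
  have h4 : muntzForm hb hσ hα hβ (ψ - χ) (ψ - χ) =
      muntzForm hb hσ hα hβ ψ (ψ - χ) - muntzForm hb hσ hα hβ χ (ψ - χ) := by
    rw [map_sub (muntzForm hb hσ hα hβ), LinearMap.sub_apply]
  linarith

theorem IsMuntzProj.sqError_le (hb : 0 < b) (hσ : 0 < σ) (hα : -1 < α) (hβ : -1 < β)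
    {v : ℝ → ℝ} (hv : MemLp v 2 (jacobiMeasure b α β σ)) {n : ℕ} {ψ : Polynomial ℝ}
    (hψ : IsMuntzProj b α β σ n v ψ) :
    sqError b α β σ v ψ ≤ ∫ x, v x * v x ∂jacobiMeasure b α β σ := by
  have h1 := hψ.2 ψ hψ.1
  rw [integral_sub_mul_muntz hb hσ hα hβ hv] at h1
  have h2 : 0 ≤ muntzForm hb hσ hα hβ ψ ψ := integral_nonneg fun x => mul_self_nonneg _
  rw [sqError, integral_sub_muntz_sq hb hσ hα hβ hv]
  linarith

/-- The projection error of `v` is controlled by the approximation error of its derivative. -/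
theorem IsMuntzProj.sqError_le_deriv (hb : 0 < b) (hσ : 0 < σ) (hα : -1 < α) (hβ : -1 < β)
    {v g : ℝ → ℝ} (hv : MemL2 b (w b α β σ) v) (hg : MemL2 b (w b (α + 1) (β + 1) σ) g)
    (hvg : IsWeakDy b σ v g) {n : ℕ} (hn : 0 < n) {ψ χ : Polynomial ℝ}
    (hψ : IsMuntzProj b α β σ (n + 1) v ψ) (hχ : χ.degree < n) :
    sqError b α β σ v ψ ≤ 4 / ((b ^ σ) ^ 2 * n ^ 2) * sqError b (α + 1) (β + 1) σ g χ := by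
  have hB : 0 < b ^ σ := Real.rpow_pos_of_pos hb _
  have hα' : -1 < α + 1 := by linarith
  have hβ' : -1 < β + 1 := by linarith
  have hn' : (0 : ℝ) < n := by exact_mod_cast hn
  have hv2 := hv.memLp hσ
  have hg2 := hg.memLp hσ
  refine le_of_forall_pos_le_add fun ε hε => ?_
  set Bf := muntzForm hb hσ hα hβ with hBf
  set Bf' := muntzForm hb hσ hα' hβ' with hBf'
  set L := jacobiOp α β (b ^ σ) with hL
  have hsymm := muntzForm_symm hb hσ hα hβ
  have hpos := muntzForm_pos hb hσ hα hβ
  have hnn : ∀ p, 0 ≤ Bf p p := fun p => integral_nonneg fun x => mul_self_nonneg _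
  have hLB : ∀ p s, Bf p (L s) = Bf' p.derivative s.derivative :=
    muntzForm_jacobiOp hb hσ hα hβ hα' hβ'
  have he : MemLp (fun x => v x - muntz σ ψ x) 2 (jacobiMeasure b α β σ) :=
    hv2.sub (memLp_muntz hb hσ hα hβ ψ)
  obtain ⟨p, hp⟩ := exists_muntz_approx hb hσ hα hβ he hε
  obtain ⟨r, hr, hr'⟩ := exists_representer hsymm hpos (max (n + 1) (p.natDegree + 1))
    (muntzFunctional hb hσ hα hβ he)
  have hro : ∀ q : Polynomial ℝ, q.degree < (n + 1 : ℕ) → Bf r q = 0 := fun q hq => by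
    rw [hr' q (hq.trans_le (by exact_mod_cast le_max_left _ _))]
    exact hψ.2 q hq
  have hpd : p.degree < (max (n + 1) (p.natDegree + 1) : ℕ) :=
    Polynomial.degree_le_natDegree.trans_lt
      (by exact_mod_cast (Nat.lt_succ_self _).trans_le (le_max_right _ _))
  have hE : sqError b α β σ v ψ ≤ Bf r r + ε := by
    rw [integral_sub_muntz_sq hb hσ hα hβ he, ← hr' p hpd] at hp
    have h1 := hnn (r - p)
    have h2 := hsymm r p
    simp only [map_sub, LinearMap.sub_apply] at h1
    change sqError b α β σ v ψ - 2 * Bf r p + Bf p p ≤ ε at hp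
    change Bf r p = Bf p r at h2
    linarith
  refine hE.trans (add_le_add_left ?_ _)
  -- Since α + β > -2, the second factor exceeds j - 1 ≥ n.
  have hlam : ∀ j : ℕ, n + 1 ≤ j → (n : ℝ) ^ 2 ≤ j * (j + α + β + 1) := by
    intro j hj
    have : (n : ℝ) + 1 ≤ j := by exact_mod_cast hj
    nlinarith
  obtain ⟨s, -, hs, hsκ⟩ := exists_preimage_of_orthogonal hsymm hpos (L := L)
    (lam := fun j => j * (j + α + β + 1)) (κ := (n : ℝ) ^ 2) (N := n + 1)
    (fun p q => by
      change Bf p (L q) = Bf q (L p)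
      rw [hLB, hLB]
      exact muntzForm_symm hb hσ hα' hβ' _ _)
    (jacobiOp_coeff α β (b ^ σ)) (by positivity) hlam (le_max_left _ _) hr hro
  -- The antiderivative q has degree at most n, so (χ, s') = (q, L s) = (q, r) = 0 and χ may be
  -- subtracted from g for free.
  obtain ⟨q, hq, hq'⟩ := exists_derivative_eq χ hχ
  have h1 : Bf' χ s.derivative = 0 := by
    rw [← hq', ← hLB, hs, hBf, hsymm]
    exact hro q hq
  have h2 : Bf r r = 2 / b ^ σ * ∫ x, (g x - muntz σ χ x) * muntz σ s.derivative x
      ∂jacobiMeasure b (α + 1) (β + 1) σ := by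
    have h3 : Bf r r = ∫ x, v x * muntz σ r x ∂jacobiMeasure b α β σ := by
      have h5 : Bf ψ r = 0 := by rw [hBf, hsymm]; exact hro ψ hψ.1
      have h6 := integral_sub_mul_muntz hb hσ hα hβ hv2 ψ r
      change _ = _ - Bf ψ r at h6
      rw [h5, sub_zero] at h6
      exact (hr' r hr).trans h6
    rw [h3, ← hs, integral_mul_jacobiOp hb hσ hα hβ hv hg hvg.2.2,
      integral_sub_mul_muntz hb hσ hα' hβ' hg2]
    change _ = 2 / b ^ σ * (_ - Bf' χ s.derivative)
    rw [h1, sub_zero, muntzFunctional_apply]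
  have h3 : Bf' s.derivative s.derivative = Bf s r := by rw [← hLB, hs]
  have h4 := integral_mul_sq_le (hg2.sub (memLp_muntz hb hσ hα' hβ' χ))
    (memLp_muntz hb hσ hα' hβ' s.derivative)
  set G := sqError b (α + 1) (β + 1) σ g χ with hG
  have hG0 : 0 ≤ G := integral_nonneg fun x => mul_self_nonneg _
  change (∫ x, (g x - muntz σ χ x) * muntz σ s.derivative x
      ∂jacobiMeasure b (α + 1) (β + 1) σ) ^ 2 ≤ G * Bf' s.derivative s.derivative at h4
  rw [h3] at h4
  set I := ∫ x, (g x - muntz σ χ x) * muntz σ s.derivative x ∂jacobiMeasure b (α + 1) (β + 1) σ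
  change (n : ℝ) ^ 2 * Bf s r ≤ Bf r r at hsκ
  -- Cauchy–Schwarz bounds (r, r)² by a multiple of (r, r), which is cancelled when it is nonzero.
  rcases (hnn r).eq_or_lt with h0 | h0
  · rw [← h0]
    positivity
  · rw [div_mul_eq_mul_div, le_div_iff₀ (by positivity)]
    refine le_of_mul_le_mul_right ?_ h0
    calc Bf r r * ((b ^ σ) ^ 2 * n ^ 2) * Bf r r = n ^ 2 * (b ^ σ * Bf r r) ^ 2 := by ring
      _ = n ^ 2 * (2 * I) ^ 2 := by rw [h2]; field_simp
      _ = n ^ 2 * (4 * I ^ 2) := by ring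
      _ ≤ n ^ 2 * (4 * (G * Bf s r)) := by gcongr
      _ = 4 * G * (n ^ 2 * Bf s r) := by ring
      _ ≤ 4 * G * Bf r r := by gcongr

/-- The chosen representative is itself a weak derivative, so the estimates apply to it directly,
without uniqueness of weak derivatives. -/
theorem MemB.isWeakDy {m : ℕ} {v : ℝ → ℝ} (h : MemB b α β σ (m + 1) v) :
    IsWeakDy b σ v (Dy b σ v) := by
  have h0 : ∃ g, IsWeakDy b σ v g := h.1 0 m.succ_pos
  rw [Dy, dif_pos h0]
  exact h0.choose_spec

theorem MemB.Dy {m : ℕ} {v : ℝ → ℝ} (h : MemB b α β σ (m + 1) v) :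
    MemB b (α + 1) (β + 1) σ m (Dy b σ v) := by
  refine ⟨fun k hk => h.1 (k + 1) (by omega), fun k hk => ?_⟩
  have := h.2 (k + 1) (by omega)
  push_cast at this
  rwa [show α + (k + 1 : ℝ) = α + 1 + k by ring, show β + (k + 1 : ℝ) = β + 1 + k by ring] at this

theorem MemB.memL2 {m : ℕ} {v : ℝ → ℝ} (h : MemB b α β σ m v) : MemL2 b (w b α β σ) v := by
  simpa using h.2 0 m.zero_le

/-- Each derivative costs one degree, so the successive gains are n, n - 1, ..., n - m + 1. The
number R is a common lower bound for them, fixed through the induction. -/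
theorem MemB.sqError_le (hb : 0 < b) (hσ : 0 < σ) {m : ℕ} (hα : -1 < α) (hβ : -1 < β)
    {v : ℝ → ℝ} (hv : MemB b α β σ m v) {n : ℕ} {R : ℝ} (hR : 0 < R) (hmn : R + m ≤ n + 1)
    (hmn' : m ≤ n) {ψ : Polynomial ℝ} (hψ : IsMuntzProj b α β σ (n + 1) v ψ) :
    sqError b α β σ v ψ ≤ (4 / ((b ^ σ) ^ 2 * R ^ 2)) ^ m *
      wInner b (w b (α + m) (β + m) σ) ((JacobiMuntz.Dy b σ)^[m] v)
        ((JacobiMuntz.Dy b σ)^[m] v) := by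
  have hB : 0 < b ^ σ := Real.rpow_pos_of_pos hb _
  induction m generalizing α β v n ψ with
  | zero =>
    rw [wInner_eq hσ]
    simpa using hψ.sqError_le hb hσ hα hβ (hv.memL2.memLp hσ)
  | succ m ih =>
    have hα' : -1 < α + 1 := by linarith
    have hβ' : -1 < β + 1 := by linarith
    obtain ⟨n, rfl⟩ : ∃ k, n = k + 1 := ⟨n - 1, by omega⟩
    push_cast at hmn
    obtain ⟨χ, hχ⟩ := exists_isMuntzProj hb hσ hα' hβ' (hv.Dy.memL2.memLp hσ) (n + 1)
    have h1 := hψ.sqError_le_deriv hb hσ hα hβ hv.memL2 hv.Dy.memL2 hv.isWeakDy n.succ_pos hχ.1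
    have h2 := ih hα' hβ' hv.Dy (by linarith) (by omega) hχ
    rw [show α + 1 + (m : ℝ) = α + (m + 1 : ℕ) by push_cast; ring,
      show β + 1 + (m : ℝ) = β + (m + 1 : ℕ) by push_cast; ring] at h2
    have hG : 0 ≤ sqError b (α + 1) (β + 1) σ (JacobiMuntz.Dy b σ v) χ :=
      integral_nonneg fun x => mul_self_nonneg _
    have hm : (0 : ℝ) ≤ m := m.cast_nonneg
    have hRn : R ≤ ((n + 1 : ℕ) : ℝ) := by push_cast; linarith
    calc _ ≤ _ := h1
      _ ≤ 4 / ((b ^ σ) ^ 2 * R ^ 2) * sqError b (α + 1) (β + 1) σ (JacobiMuntz.Dy b σ v) χ := by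
        gcongr
      _ ≤ 4 / ((b ^ σ) ^ 2 * R ^ 2) * _ := mul_le_mul_of_nonneg_left h2 (by positivity)
      _ = _ := by rw [← mul_assoc, ← pow_succ']; rfl

theorem measurable_muntz (hσ : 0 < σ) (p : Polynomial ℝ) : Measurable (muntz σ p) :=
  (continuous_muntz hσ p).measurable

/-- Projection estimate in a space obtained from Müntz polynomials by a multiplier `A`. -/
theorem orthProj_of_multiplier (hb : 0 < b) (hσ : 0 < σ) (hα : -1 < α) (hβ : -1 < β)
    {m N : ℕ} (hmN : m ≤ N) {A ρ u v : ℝ → ℝ} (hA : Measurable A)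
    (hρ : ∀ x ∈ Ioo 0 b, A x * A x * ρ x = w b α β σ x)
    (hu : ∀ x ∈ Ioo 0 b, u x = A x * v x) (hv : MemB b α β σ m v) {F : Set (ℝ → ℝ)}
    (hF : F = {φ | ∃ ψ : Polynomial ℝ, ψ.natDegree ≤ N ∧ φ = fun x => A x * ψ.eval (x ^ σ)}) :
    (∃! p, IsOrthProj b ρ F u p) ∧ ∀ p, IsOrthProj b ρ F u p →
      MemL2 b ρ (p - u) ∧ wNorm b ρ (p - u) ≤
        (2 * (m + 1) / b ^ σ) ^ m * (N : ℝ) ^ (-(m : ℤ)) *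
          wNorm b (w b (α + m) (β + m) σ) ((Dy b σ)^[m] v) := by
  subst hF
  have hB : 0 < b ^ σ := Real.rpow_pos_of_pos hb _
  have hv2 := hv.memL2.memLp hσ
  have hdeg : ∀ p : Polynomial ℝ, p.natDegree ≤ N ↔ p.degree < (N + 1 : ℕ) := fun p => by
    rw [Polynomial.degree_lt_iff_coeff_zero, Polynomial.natDegree_le_iff_coeff_eq_zero]
    exact forall_congr' fun k => by rw [Nat.add_one_le_iff]
  have hin : ∀ ψ q : Polynomial ℝ, wInner b ρ ((fun x => A x * ψ.eval (x ^ σ)) - u)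
      (fun x => A x * q.eval (x ^ σ)) =
        -∫ x, (v x - muntz σ ψ x) * muntz σ q x ∂jacobiMeasure b α β σ := by
    intro ψ q
    rw [integral_jacobiMeasure hσ, ← integral_neg]
    refine setIntegral_congr_fun measurableSet_Ioo fun x hx => ?_
    simp only [Pi.sub_apply, hu x hx, ← hρ x hx, muntz]
    ring
  have hiff : ∀ p, IsOrthProj b ρ {φ | ∃ ψ : Polynomial ℝ, ψ.natDegree ≤ N ∧
      φ = fun x => A x * ψ.eval (x ^ σ)} u p ↔ ∃ ψ : Polynomial ℝ,
        IsMuntzProj b α β σ (N + 1) v ψ ∧ p = fun x => A x * ψ.eval (x ^ σ) := by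
    intro p
    constructor
    · rintro ⟨⟨ψ, hψ, rfl⟩, h⟩
      refine ⟨ψ, ⟨(hdeg ψ).1 hψ, fun q hq => ?_⟩, rfl⟩
      have := h _ ⟨q, (hdeg q).2 hq, rfl⟩
      rwa [hin, neg_eq_zero] at this
    · rintro ⟨ψ, ⟨hψ, h⟩, rfl⟩
      refine ⟨⟨ψ, (hdeg ψ).2 hψ, rfl⟩, ?_⟩
      rintro _ ⟨q, hq, rfl⟩
      rw [hin, h q ((hdeg q).1 hq), neg_zero]
  -- A projection, as a function on all of ℝ, is determined by its polynomial, so uniqueness holds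
  -- literally and not just almost everywhere.
  simp only [hiff]
  constructor
  · obtain ⟨ψ, hψ⟩ := exists_isMuntzProj hb hσ hα hβ hv2 (N + 1)
    refine ⟨_, ⟨ψ, hψ, rfl⟩, ?_⟩
    rintro _ ⟨χ, hχ, rfl⟩
    rw [hψ.unique hb hσ hα hβ hv2 hχ]
  rintro _ ⟨ψ, hψ, rfl⟩
  set p : ℝ → ℝ := fun x => A x * ψ.eval (x ^ σ)
  have hpu : ∀ x ∈ Ioo 0 b, (p - u) x = A x * (muntz σ ψ x - v x) := fun x hx => by
    simp only [Pi.sub_apply, hu x hx, muntz, p]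
    ring
  have hsq : ∀ x ∈ Ioo 0 b, (v x - muntz σ ψ x) * (v x - muntz σ ψ x) * w b α β σ x =
      (p - u) x * (p - u) x * ρ x := fun x hx => by
    rw [hpu x hx, ← hρ x hx]
    ring
  refine ⟨⟨?_, ?_⟩, ?_⟩
  · refine (hA.aestronglyMeasurable.mul
      ((measurable_muntz hσ ψ).aestronglyMeasurable.sub hv.memL2.1)).congr ?_
    filter_upwards [ae_restrict_mem measurableSet_Ioo] with x hx using (hpu x hx).symm
  · have he := hv2.sub (memLp_muntz hb hσ hα hβ ψ)
    exact ((integrable_jacobiMeasure_iff hσ).1 (he.integrable_mul he)).congr_fun hsq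
      measurableSet_Ioo
  · have e1 : wInner b ρ (p - u) (p - u) = sqError b α β σ v ψ := by
      rw [sqError, integral_jacobiMeasure hσ]
      exact (setIntegral_congr_fun measurableSet_Ioo hsq).symm
    have hmN' : (m : ℝ) ≤ N := by exact_mod_cast hmN
    have hm0 : (0 : ℝ) ≤ m := m.cast_nonneg
    have hR : (0 : ℝ) < N - m + 1 := by linarith
    have h := hv.sqError_le hb hσ hα hβ hR (by linarith) hmN hψ
    rw [wNorm, e1]
    refine (Real.sqrt_le_sqrt h).trans ?_
    have e2 : (4 / ((b ^ σ) ^ 2 * ((N : ℝ) - m + 1) ^ 2)) ^ m =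
        ((2 / (b ^ σ * ((N : ℝ) - m + 1))) ^ m) ^ 2 := by
      rw [← pow_mul, mul_comm m, pow_mul]
      congr 1
      rw [div_pow, mul_pow]
      norm_num
    rw [e2, Real.sqrt_mul (sq_nonneg _), Real.sqrt_sq (by positivity), ← wNorm]
    refine mul_le_mul_of_nonneg_right ?_ (Real.sqrt_nonneg _)
    rw [zpow_neg, zpow_natCast, ← inv_pow, ← mul_pow]
    -- For m = 0 both factors are 1, even if N = 0; for m > 0 the bound m ≤ N makes N positive.
    rcases m.eq_zero_or_pos with rfl | hm
    · simp
    refine pow_le_pow_left₀ (by positivity) ?_ _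
    have hm1 : (1 : ℝ) ≤ m := by exact_mod_cast hm
    have hN : (0 : ℝ) < N := by linarith
    rw [← div_eq_mul_inv, div_div, div_le_div_iff₀ (by positivity) (by positivity)]
    -- The difference of the two sides is m(N - m) + 1. This trades N - m + 1 for N at the price of
    -- the factor m + 1 in the constant.
    have : (N : ℝ) ≤ (m + 1) * (N - m + 1) := by nlinarith
    calc 2 * (b ^ σ * N) ≤ 2 * (b ^ σ * ((m + 1) * (N - m + 1))) := by gcongr
      _ = _ := by ring

end Projection

end JacobiMuntz

theorem mainTheorem3 (α β σ b : ℝ) (hα : -1 < α) (hβ : -1 < β) (hσ : 0 < σ) (hb : 0 < b)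
    (m : ℕ) :
    ∃ c : ℝ, 0 < c ∧ ∀ (μ η : ℝ) (N : ℕ), m ≤ N → ∀ u : ℝ → ℝ,
      (JacobiMuntz.MemB b α β σ m (fun x => x ^ (-(σ * (β - η - μ))) * u x) →
        (∃! p, JacobiMuntz.IsOrthProj b (JacobiMuntz.w1 b α β μ σ η)
          (JacobiMuntz.F1 β μ σ η N) u p) ∧
        ∀ p, JacobiMuntz.IsOrthProj b (JacobiMuntz.w1 b α β μ σ η)
            (JacobiMuntz.F1 β μ σ η N) u p →
          JacobiMuntz.MemL2 b (JacobiMuntz.w1 b α β μ σ η) (p - u) ∧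
          JacobiMuntz.wNorm b (JacobiMuntz.w1 b α β μ σ η) (p - u) ≤
            c * (N : ℝ) ^ (-(m : ℤ)) *
              JacobiMuntz.wNorm b (JacobiMuntz.w b (α + m) (β + m) σ)
                ((JacobiMuntz.Dy b σ)^[m] (fun x => x ^ (-(σ * (β - η - μ))) * u x))) ∧
      (JacobiMuntz.MemB b α β σ m
          (fun x => x ^ (-(σ * η)) * (b ^ σ - x ^ σ) ^ (-α) * u x) →
        (∃! p, JacobiMuntz.IsOrthProj b (JacobiMuntz.w2 b α β σ η)
          (JacobiMuntz.F2 b α σ η N) u p) ∧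
        ∀ p, JacobiMuntz.IsOrthProj b (JacobiMuntz.w2 b α β σ η)
            (JacobiMuntz.F2 b α σ η N) u p →
          JacobiMuntz.MemL2 b (JacobiMuntz.w2 b α β σ η) (p - u) ∧
          JacobiMuntz.wNorm b (JacobiMuntz.w2 b α β σ η) (p - u) ≤
            c * (N : ℝ) ^ (-(m : ℤ)) *
              JacobiMuntz.wNorm b (JacobiMuntz.w b (α + m) (β + m) σ)
                ((JacobiMuntz.Dy b σ)^[m]
                  (fun x => x ^ (-(σ * η)) * (b ^ σ - x ^ σ) ^ (-α) * u x))) := by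
  have hB : 0 < b ^ σ := Real.rpow_pos_of_pos hb _
  -- The parameters μ and η enter only through the multiplier A, so the constant is free of them.
  refine ⟨(2 * (m + 1) / b ^ σ) ^ m, by positivity, fun μ η N hmN u => ⟨fun hv => ?_, fun hv => ?_⟩⟩
  · refine JacobiMuntz.orthProj_of_multiplier hb hσ hα hβ hmN
      (A := fun x => x ^ (σ * (β - η - μ))) (by fun_prop)
      (fun x hx => ?_) (fun x hx => ?_) hv rfl
    · have h : x ^ (σ * (β + 1) - 1) = x ^ (σ * (β - η - μ)) * x ^ (σ * (β - η - μ)) *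
          (x ^ (σ - 1) * x ^ (σ * (2 * (η + μ) - β))) := by
        rw [← Real.rpow_add hx.1, ← Real.rpow_add hx.1, ← Real.rpow_add hx.1]
        ring_nf
      rw [JacobiMuntz.w, JacobiMuntz.w1, h]
      ring
    · rw [Real.rpow_neg hx.1.le, mul_inv_cancel_left₀ (Real.rpow_pos_of_pos hx.1 _).ne']
  · refine JacobiMuntz.orthProj_of_multiplier hb hσ hα hβ hmN
      (A := fun x => x ^ (σ * η) * (b ^ σ - x ^ σ) ^ α) (by fun_prop)
      (fun x hx => ?_) (fun x hx => ?_) hv rfl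
    · have hs := JacobiMuntz.rpow_lt_of_mem hσ hx
      have h : x ^ (σ * (β + 1) - 1) = x ^ (σ * η) * x ^ (σ * η) *
          (x ^ (σ - 1) * x ^ (σ * (β - 2 * η))) := by
        rw [← Real.rpow_add hx.1, ← Real.rpow_add hx.1, ← Real.rpow_add hx.1]
        ring_nf
      have h' : (b ^ σ - x ^ σ) ^ α ≠ 0 := (Real.rpow_pos_of_pos hs _).ne'
      rw [JacobiMuntz.w, JacobiMuntz.w2, h, Real.rpow_neg hs.le]
      field_simp
    · have hs := JacobiMuntz.rpow_lt_of_mem hσ hx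
      have h' : (b ^ σ - x ^ σ) ^ α ≠ 0 := (Real.rpow_pos_of_pos hs _).ne'
      have h'' : x ^ (σ * η) ≠ 0 := (Real.rpow_pos_of_pos hx.1 _).ne'
      rw [Real.rpow_neg hx.1.le, Real.rpow_neg hs.le]
      field_simp
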